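/- Let $M\subset\mathbb R^p\times\mathbb R^q$ be open, with coordinates $x=(x^1,\dots,x^p)$ and $u=(u^1,\dots,u^q)$, and let $r>0$, $N\in\mathbb N$. Let $\mathscr A$ be the algebra of differential functions $P[u,\varepsilon]=P(x,u^{(n)},\varepsilon)$ over $M$: smooth functions of $x$, $u$, finitely many derivatives $u^\alpha_J$, and the parameter $\varepsilon\in(-r,r)$. Let $D_i$ be the total derivatives and $\delta$ the variational derivative (Euler operator). Functionals $\int L\,dx$, $L\in\mathscr A$, are taken modulo total divergences of elements of $\mathscr A$. A function in $\mathscr A$ is $o(\varepsilon^N)$ if it is so as $\varepsilon\to0$ at every point, and a functional $\int L\,dx$ is $o(\varepsilon^N)$ if $L$ is the sum of a total divergence and an $o(\varepsilon^N)$ function. The same conventions are used for functional multi-vectors, i.e. alternating expressions in symbols $\theta^\alpha_J$ with coefficients in $\mathscr A$, on which $D_i$ acts as the derivation with $D_i\theta^\alpha_J=\theta^\alpha_{J,i}$, taken modulo total divergences; such an expression is $o(\varepsilon^N)$ if all its coefficients are. A $q\times q$ matrix $\mathscr D$ of differential operators $\sum_J P_JD_J$ (finite sums, $P_J\in\mathscr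 A$) is *skew-adjoint* if $\int (P\cdot\mathscr DQ+Q\cdot\mathscr DP)\,dx=0$ for all $P,Q\in\mathscr A^q$. It is *Hamiltonian* if the bracket $\{\mathscr P,\mathscr L\}=\int\delta\mathscr P\cdot\mathscr D\,\delta\mathscr L\,dx$ is skew-symmetric and satisfies the Jacobi identity, and *approximate Hamiltonian* if these two conditions hold up to $o(\varepsilon^N)$. Operators $\mathscr D,\mathscr E$ form an *approximately Hamiltonian pair* if both are skew-adjoint and $a\mathscr D+b\mathscr E$ is approximate Hamiltonian for all $a,b\in\mathbb R$. **Corollary.** Let $\mathscr D$ and $\mathscr E$ be Hamiltonian operators. Then $\mathscr D,\mathscr E$ form an approximately Hamiltonian pair if and only if $$\mathbf{pr\,v}_{\mathscr D\theta}(\Theta_{\mathscr E})+\mathbf{pr\,v}_{\mathscr E\theta}(\Theta_{\mathscr D})=o(\varepsilon^N),$$ where $\Theta_{\mathscr D}=\frac12\int\{\theta\wedge\mathscr D\theta\}\,dx$ and $\Theta_{\mathscr E}=\frac12\int\{\theta\wedge\mathscr E\theta\}\,dx$ are the functional bi-vectors of the two Poisson brackets, and $\mathbf{pr\,v}_{\mathscr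 D\theta}=\sum_{\alpha,J}D_J\big((\mathscr D\theta)_\alpha\big)\,\partial/\partial u^\alpha_J$ acts on the coefficients of multi-vectors, the uni-vectors $D_J((\mathscr D\theta)_\alpha)$ being wedged in from the left. The same equivalence holds if $\mathscr D$ and $\mathscr E$ are only assumed to be skew-adjoint and approximate Hamiltonian. -/

import Mathlib

open scoped ContDiff Topology

noncomputable section

namespace ApproxHam

/-- Symmetric multi-indices: `J i` counts the differentiations with respect to `x i`. -/
abbrev MultiIndex (p : ℕ) : Type := Fin p →₀ ℕ

/-- Coordinates on the infinite jet space of `p` independent and `q` dependent variables,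
together with the small parameter: `x i`, `u α J` (the jet variable `u^α_J`) and `eps`. -/
inductive Coord (p q : ℕ) : Type where
  | x (i : Fin p) : Coord p q
  | u (α : Fin q) (J : MultiIndex p) : Coord p q
  | eps : Coord p q

instance (p q : ℕ) : DecidableEq (Coord p q) := Classical.decEq _

/-- Points of the infinite jet space, together with a value of the parameter. -/
abbrev Jet (p q : ℕ) : Type := Coord p q → ℝ

/-- An open set `M` in the space of the variables `(x, u)`. -/
abbrev BaseDomain (p q : ℕ) : Type := TopologicalSpace.Opens ((Fin p → ℝ) × (Fin q → ℝ))

/-- The jets over `M`, with parameter values in the interval `(-r, r)`. Only `x` and `u` (not the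
derivatives of `u`) are restricted by `M`. -/
def jetDomain {p q : ℕ} (M : BaseDomain p q) (r : ℝ) : Set (Jet p q) :=
  {z | ((fun i => z (.x i)), (fun α => z (.u α 0))) ∈ M ∧ z .eps ∈ Set.Ioo (-r) r}

variable {p q : ℕ} {M : BaseDomain p q} {r : ℝ}

theorem isOpen_jetDomain : IsOpen (jetDomain M r) := by
  have h1 : Continuous (fun z : Jet p q =>
      ((fun i : Fin p => z (.x i)), (fun α : Fin q => z (.u α 0)))) := by fun_prop
  have h2 : Continuous (fun z : Jet p q => z .eps) := by fun_prop
  exact (M.isOpen.preimage h1).inter (isOpen_Ioo.preimage h2)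

/-- `f` is a smooth function of finitely many of the coordinates: `f = P(x, u⁽ⁿ⁾, ε)`.
(The points at which `g` has to be smooth form an open set.) -/
def IsDifferentialFunction (f : jetDomain M r → ℝ) : Prop :=
  ∃ (S : Finset (Coord p q)) (g : (S → ℝ) → ℝ), ∀ z : jetDomain M r,
    ContDiffAt ℝ ∞ g (fun c => z.1 c.1) ∧ f z = g (fun c => z.1 c.1)

theorem IsDifferentialFunction.comp₂ {f₁ f₂ : jetDomain M r → ℝ}
    (h₁ : IsDifferentialFunction f₁) (h₂ : IsDifferentialFunction f₂)
    {φ : ℝ × ℝ → ℝ} (hφ : ContDiff ℝ ∞ φ) :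
    IsDifferentialFunction (fun z => φ (f₁ z, f₂ z)) := by
  obtain ⟨S₁, g₁, h₁⟩ := h₁
  obtain ⟨S₂, g₂, h₂⟩ := h₂
  let i₁ : S₁ → ↥(S₁ ∪ S₂) := fun c => ⟨c.1, Finset.mem_union_left _ c.2⟩
  let i₂ : S₂ → ↥(S₁ ∪ S₂) := fun c => ⟨c.1, Finset.mem_union_right _ c.2⟩
  refine ⟨S₁ ∪ S₂, fun w => φ (g₁ (fun c => w (i₁ c)), g₂ (fun c => w (i₂ c))), fun z => ⟨?_, ?_⟩⟩
  · have e₁ : ContDiff ℝ ∞ (fun w : ↥(S₁ ∪ S₂) → ℝ => fun c => w (i₁ c)) := by fun_prop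
    have e₂ : ContDiff ℝ ∞ (fun w : ↥(S₁ ∪ S₂) → ℝ => fun c => w (i₂ c)) := by fun_prop
    have k₁ := ContDiffAt.comp (fun c : ↥(S₁ ∪ S₂) => z.1 c.1) (h₁ z).1 e₁.contDiffAt
    have k₂ := ContDiffAt.comp (fun c : ↥(S₁ ∪ S₂) => z.1 c.1) (h₂ z).1 e₂.contDiffAt
    exact hφ.contDiffAt.comp (fun c : ↥(S₁ ∪ S₂) => z.1 c.1) (k₁.prodMk k₂)
  · simp only [(h₁ z).2, (h₂ z).2, i₁, i₂]

variable (M r) in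
/-- The algebra `𝒜` of differential functions `P[u, ε] = P(x, u⁽ⁿ⁾, ε)` over `M`. -/
def 𝒜 : Subalgebra ℝ (jetDomain M r → ℝ) where
  carrier := {f | IsDifferentialFunction f}
  add_mem' h₁ h₂ := h₁.comp₂ h₂ (φ := fun y => y.1 + y.2) (by fun_prop)
  mul_mem' h₁ h₂ := h₁.comp₂ h₂ (φ := fun y => y.1 * y.2) (by fun_prop)
  algebraMap_mem' a := ⟨∅, fun _ => a, fun _ => ⟨contDiffAt_const, rfl⟩⟩

/-- A coordinate, as a differential function. -/
def coordFun (c : Coord p q) : 𝒜 M r :=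
  ⟨fun z => z.1 c, {c}, fun w => w ⟨c, Finset.mem_singleton_self c⟩, fun z =>
    ⟨(by fun_prop : ContDiff ℝ ∞ fun w : ({c} : Finset (Coord p q)) → ℝ =>
      w ⟨c, Finset.mem_singleton_self c⟩).contDiffAt, rfl⟩⟩

/-- Restriction of `f` to the line through `z` in the direction of the coordinate `c` (with value
`0` where this line has left the domain). -/
def slice (f : jetDomain M r → ℝ) (c : Coord p q) (z : jetDomain M r) (s : ℝ) : ℝ :=
  Function.extend Subtype.val f 0 (Function.update z.1 c s)

/-- The partial derivative of a function on the jet domain with respect to the coordinate `c`. -/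
def rawPartial (c : Coord p q) (f : jetDomain M r → ℝ) (z : jetDomain M r) : ℝ :=
  deriv (slice f c z) (z.1 c)

theorem slice_eventuallyEq {f : jetDomain M r → ℝ} {S : Finset (Coord p q)} {g : (S → ℝ) → ℝ}
    (h : ∀ z : jetDomain M r, f z = g (fun c => z.1 c.1)) (c : Coord p q) (z : jetDomain M r) :
    slice f c z =ᶠ[𝓝 (z.1 c)] fun s => g (fun d => Function.update z.1 c s d.1) := by
  have hc : Continuous (fun s : ℝ => Function.update z.1 c s) :=
    continuous_const.update c continuous_id
  have hz : (fun s : ℝ => Function.update z.1 c s) ⁻¹' jetDomain M r ∈ 𝓝 (z.1 c) := by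
    refine (isOpen_jetDomain.preimage hc).mem_nhds ?_
    simp [z.2]
  filter_upwards [hz] with s hs
  have := Subtype.val_injective.extend_apply f 0 (⟨_, hs⟩ : jetDomain M r)
  simp only [slice]
  rw [this, h]

theorem rawPartial_eq {f : jetDomain M r → ℝ} {S : Finset (Coord p q)} {g : (S → ℝ) → ℝ}
    (h : ∀ z : jetDomain M r, ContDiffAt ℝ ∞ g (fun c => z.1 c.1) ∧ f z = g (fun c => z.1 c.1))
    (c : Coord p q) (z : jetDomain M r) :
    rawPartial c f z = fderiv ℝ g (fun c => z.1 c.1) (fun d => if d.1 = c then 1 else 0) := by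
  unfold rawPartial
  rw [(slice_eventuallyEq (fun z => (h z).2) c z).deriv_eq]
  have h1 : HasDerivAt (fun s : ℝ => fun d : S => Function.update z.1 c s d.1)
      (fun d => if d.1 = c then 1 else 0) (z.1 c) := by
    rw [hasDerivAt_pi]
    intro d
    by_cases hd : d.1 = c
    · simpa [hd] using hasDerivAt_id' (z.1 c)
    · simpa [hd] using hasDerivAt_const (z.1 c) (z.1 d.1)
  have h2 : DifferentiableAt ℝ g (fun d : S => Function.update z.1 c (z.1 c) d.1) := by
    simpa using (h z).1.differentiableAt (by simp)
  simpa [Function.comp_def] using (h2.hasFDerivAt.comp_hasDerivAt (z.1 c) h1).deriv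

theorem IsDifferentialFunction.rawPartial {f : jetDomain M r → ℝ}
    (h : IsDifferentialFunction f) (c : Coord p q) :
    IsDifferentialFunction (rawPartial c f) := by
  obtain ⟨S, g, h⟩ := h
  refine ⟨S, fun w => fderiv ℝ g w (fun d => if d.1 = c then 1 else 0), fun z => ⟨?_, ?_⟩⟩
  · exact ((h z).1.fderiv_right (m := ∞) (by simp)).clm_apply contDiffAt_const
  · exact rawPartial_eq h c z

/-- The partial derivative `∂/∂c` on differential functions. -/
def pderiv (c : Coord p q) (f : 𝒜 M r) : 𝒜 M r := ⟨rawPartial c f.1, f.2.rawPartial c⟩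

/-- A differential function depends on finitely many coordinates only; so all the sums over
multi-indices below have finitely many nonzero terms. -/
theorem finite_pderiv_ne_zero (f : 𝒜 M r) : {c | pderiv c f ≠ 0}.Finite := by
  obtain ⟨f, S, g, h⟩ := f
  refine S.finite_toSet.subset fun c hc => ?_
  by_contra hcS
  refine hc (Subtype.ext (funext fun z => ?_))
  change rawPartial c f z = 0
  rw [rawPartial_eq h]
  have : (fun d : S => if d.1 = c then (1 : ℝ) else 0) = 0 := by
    funext d
    have : d.1 ≠ c := fun e => hcS (by simp [← e])
    simp [this]
  rw [this, map_zero]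

/-- Labels `(α, J)` of the jet variables `u^α_J` and of the basic uni-vectors `θ^α_J`. -/
abbrev Lab (p q : ℕ) : Type := Fin q × MultiIndex p

/-- `(α, J) ↦ (α, (J, i))`. -/
def Lab.incr (i : Fin p) (c : Lab p q) : Lab p q := (c.1, c.2 + Finsupp.single i 1)

/-- The jet variable `u^α_J`, where `c = (α, J)`. -/
def Lab.u (c : Lab p q) : Coord p q := .u c.1 c.2

/-- The total derivative `D_i = ∂/∂x^i + ∑ u^α_{J,i} ∂/∂u^α_J`. -/
def totalDeriv (i : Fin p) (f : 𝒜 M r) : 𝒜 M r :=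
  pderiv (.x i) f + ∑ᶠ c : Lab p q, coordFun (c.incr i).u * pderiv c.u f

/-- Iterated operators `T_J = ∏_i T_i ^ (J i)` (used for commuting operators only). -/
def iterOp {V : Type*} (T : Fin p → V → V) (J : MultiIndex p) (v : V) : V :=
  (List.finRange p).foldr (fun i w => (T i)^[J i] w) v

/-- The total divergence. -/
def divergence (X : Fin p → 𝒜 M r) : 𝒜 M r := ∑ i, totalDeriv i (X i)

/-- The Euler operator (variational derivative): the density of a functional is sent to
`E_α(L) = ∑_J (-D)_J ∂L/∂u^α_J`. -/
def euler (L : 𝒜 M r) (α : Fin q) : 𝒜 M r :=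
  ∑ᶠ J : MultiIndex p, (-1 : 𝒜 M r) ^ J.degree * iterOp totalDeriv J (pderiv (.u α J) L)

/-- `f = o(ε^N)`. As `f` is jointly smooth, it makes no difference whether this is
required at each point or locally uniformly. -/
def IsSmall (N : ℕ) (f : 𝒜 M r) : Prop :=
  ∀ z : jetDomain M r, slice f.1 .eps z =o[𝓝 0] fun e : ℝ => e ^ N

/-- The functional `∫ L dx` vanishes: functionals are densities modulo total divergences. -/
def IntegralZero (L : 𝒜 M r) : Prop := ∃ X : Fin p → 𝒜 M r, L = divergence X

/-- The functional `∫ L dx` is `o(ε^N)`. -/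
def IntegralSmall (N : ℕ) (L : 𝒜 M r) : Prop :=
  ∃ X : Fin p → 𝒜 M r, IsSmall N (L - divergence X)

variable (M r) in
/-- A `q × q` matrix of differential operators `𝒟_{αβ} = ∑_J P_J[u, ε] D_J`, given by its
coefficients: `P_J = 𝒟 α β J`. -/
abbrev MatDiffOp : Type := Matrix (Fin q) (Fin q) (MultiIndex p →₀ 𝒜 M r)

/-- The action of a matrix differential operator on `𝒜^q`. -/
def MatDiffOp.apply (D : MatDiffOp M r) (Q : Fin q → 𝒜 M r) (α : Fin q) : 𝒜 M r :=
  ∑ β, (D α β).sum fun J P => P * iterOp totalDeriv J (Q β)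

/-- `D'` is the formal adjoint of `D`: `∫ P · D Q dx = ∫ Q · D' P dx`. -/
def IsAdjoint (D D' : MatDiffOp M r) : Prop :=
  ∀ P Q : Fin q → 𝒜 M r,
    IntegralZero (∑ α, P α * MatDiffOp.apply D Q α - ∑ α, Q α * MatDiffOp.apply D' P α)

/-- `D* = -D`. -/
def IsSkewAdjoint (D : MatDiffOp M r) : Prop := IsAdjoint D (-D)

/-- A density of the bracket `{∫ P dx, ∫ L dx} = ∫ δP · D δL dx`. -/
def bracket (D : MatDiffOp M r) (P L : 𝒜 M r) : 𝒜 M r :=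
  ∑ α, euler P α * MatDiffOp.apply D (euler L) α

/-- `D` is Hamiltonian: its bracket is skew-symmetric and satisfies the Jacobi identity. -/
def IsHamiltonian (D : MatDiffOp M r) : Prop :=
  (∀ P L : 𝒜 M r, IntegralZero (bracket D P L + bracket D L P)) ∧
  ∀ P L R : 𝒜 M r, IntegralZero (bracket D (bracket D P L) R + bracket D (bracket D L R) P +
    bracket D (bracket D R P) L)

/-- `D` is approximate Hamiltonian: skew-symmetry and the Jacobi identity hold up to `o(ε^N)`. -/
def IsApproxHamiltonian (N : ℕ) (D : MatDiffOp M r) : Prop :=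
  (∀ P L : 𝒜 M r, IntegralSmall N (bracket D P L + bracket D L P)) ∧
  ∀ P L R : 𝒜 M r, IntegralSmall N (bracket D (bracket D P L) R + bracket D (bracket D L R) P +
    bracket D (bracket D R P) L)

/-- `D`, `E` are skew-adjoint and every real linear combination of them is approximate
Hamiltonian. -/
def IsApproxHamiltonianPair (N : ℕ) (D E : MatDiffOp M r) : Prop :=
  IsSkewAdjoint D ∧ IsSkewAdjoint E ∧ ∀ a b : ℝ, IsApproxHamiltonian N (a • D + b • E)

variable (M r) in
/-- Formal sums of monomials `P θ^{α₁}_{J₁} ∧ ⋯ ∧ θ^{α_k}_{J_k}` with `P` in `𝒜`: the monomial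
with labels `a` has coefficient `η a`. They represent vertical `k`-vectors; two of them represent
the same `k`-vector when their antisymmetrized coefficients (see `altCoeff`) agree. -/
abbrev MultiVec (k : ℕ) : Type := (Fin k → Lab p q) →₀ 𝒜 M r

/-- The coefficient of `θ_{a 0} ∧ ⋯ ∧ θ_{a (k-1)}` after collecting all monomials that differ by
a permutation of their factors; it is `0` if a label is repeated. -/
def altCoeff {k : ℕ} (η : MultiVec M r k) (a : Fin k → Lab p q) : 𝒜 M r :=
  ∑ σ : Equiv.Perm (Fin k), (Equiv.Perm.sign σ : ℤ) • η (a ∘ σ)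

/-- The total derivative of multi-vectors: the derivation with `D_i θ^α_J = θ^α_{J,i}` which
extends `D_i` on `𝒜`. -/
def MultiVec.totalDeriv {k : ℕ} (i : Fin p) (η : MultiVec M r k) : MultiVec M r k :=
  η.sum fun a P => Finsupp.single a (ApproxHam.totalDeriv i P) +
    ∑ s : Fin k, Finsupp.single (Function.update a s ((a s).incr i)) P

/-- The functional multi-vector `∫ η dx` is `o(ε^N)`: modulo total divergences of multi-vectors,
all its coefficients are. -/
def MultiVec.IntegralSmall {k : ℕ} (N : ℕ) (η : MultiVec M r k) : Prop :=
  ∃ X : Fin p → MultiVec M r k, ∀ a : Fin k → Lab p q,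
    IsSmall N (altCoeff (η - ∑ i, MultiVec.totalDeriv i (X i)) a)

/-- The uni-vector `(Dθ)_α = ∑_{β,J} D_{αβ}^J θ^β_J`. -/
def opTheta (D : MatDiffOp M r) (α : Fin q) : MultiVec M r 1 :=
  ∑ β, (D α β).sum fun J P => Finsupp.single (fun _ => (β, J)) P

/-- The wedge product of a uni-vector and a `k`-vector. -/
def MultiVec.wedge {k : ℕ} (v : MultiVec M r 1) (η : MultiVec M r k) : MultiVec M r (k + 1) :=
  v.sum fun b Q => η.sum fun a P => Finsupp.single (Fin.cons (b 0) a) (Q * P)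

/-- (The integrand of) the bi-vector `Θ_D = ½ ∫ {θ ∧ Dθ} dx`. -/
def bivector (D : MatDiffOp M r) : MultiVec M r 2 :=
  (1 / 2 : ℝ) • ∑ α, MultiVec.wedge (Finsupp.single (fun _ => (α, 0)) 1) (opTheta D α)

/-- `pr v_{Dθ} = ∑_{α,J} D_J((Dθ)_α) ∂/∂u^α_J`, where `∂/∂u^α_J` acts on the coefficients:
`P θ_{a₁} ∧ ⋯ ∧ θ_{a_k} ↦ ∑_{α,J} ∂P/∂u^α_J D_J((Dθ)_α) ∧ θ_{a₁} ∧ ⋯ ∧ θ_{a_k}`. -/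
def prolong {k : ℕ} (D : MatDiffOp M r) (η : MultiVec M r k) : MultiVec M r (k + 1) :=
  η.sum fun a P => ∑ᶠ c : Lab p q,
    MultiVec.wedge (iterOp MultiVec.totalDeriv c.2 (opTheta D c.1))
      (Finsupp.single a (pderiv c.u P))

end ApproxHam

end

open scoped ContDiff Topology

noncomputable section

namespace ApproxHam

variable {p q : ℕ} {M : BaseDomain p q} {r : ℝ}

/-! ### Partial derivatives -/

/-! The exact and the approximate statements are treated together by working modulo an ideal `I` of
differential functions stable under every `∂/∂c` with `c ≠ ε`: `I = 0` for the exact notions, `I =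
o(ε^N)` for the approximate ones. The second ideal is stable because `o(ε^N)` means that all
`ε`-derivatives up to order `N` vanish on `ε = 0` (`isSmall_iff`), a condition that differentiation
along the other coordinates preserves.

Let `D` be skew-adjoint modulo `I`. Expanding `{{P,L},R}` produces the term `∫ δP · D'[DδR] δL`,
with `D'` the Fréchet derivative of `D`, and terms with Fréchet derivatives of variational
derivatives. The latter are self-adjoint operators, so these terms cancel in the cyclic sum
(`integral_jacobi`). What remains, `jacobiForm I D D`, is also the value of the tri-vector `pr
v_{Dθ}(Θ_D)` on `δP, δL, δR` (`integral_pair_altL_prolong`). It is quadratic in `D`. For `aD + bE`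
the `a²` and `b²` terms vanish by hypothesis, and the coefficient of `ab` is the value of the mixed
tri-vector. Hence `D, E` form a pair exactly when the mixed tri-vector vanishes modulo `I` on all
triples of variational derivatives.

It remains to see that such a tri-vector is itself trivial (`multiVec_trivial`). Integration by
parts frees the first `θ` from derivatives. The fundamental lemma of the calculus of variations then
removes the integral, using the characteristics `φ e_α = δ(φ u^α)` and `φ u^α e_α = δ(½ φ (u^α)²)`
with `φ` free of jet variables. Finally, commutators with multiplication by `x^i` read off the
coefficients of a differential operator from its values on such `φ`. With `I = 0` the same test
functions show that a skew-symmetric bracket forces a skew-adjoint operator, so the Hamiltonian case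
reduces to the skew-adjoint approximate one. -/

theorem slice_apply (f : jetDomain M r → ℝ) (c : Coord p q) (z : jetDomain M r) {s : ℝ}
    (h : Function.update z.1 c s ∈ jetDomain M r) :
    slice f c z s = f ⟨Function.update z.1 c s, h⟩ :=
  Subtype.val_injective.extend_apply f 0 (⟨_, h⟩ : jetDomain M r)

theorem slice_self (f : jetDomain M r → ℝ) (c : Coord p q) (z : jetDomain M r) :
    slice f c z (z.1 c) = f z := by
  rw [slice_apply f c z (by simp [z.2])]
  congr 1
  exact Subtype.ext (Function.update_eq_self c z.1)

theorem eventually_update_mem (c : Coord p q) (z : jetDomain M r) :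
    ∀ᶠ s in 𝓝 (z.1 c), Function.update z.1 c s ∈ jetDomain M r := by
  have hc : Continuous (fun s : ℝ => Function.update z.1 c s) :=
    continuous_const.update c continuous_id
  exact (isOpen_jetDomain.preimage hc).mem_nhds (by simp [z.2])

theorem contDiffAt_slice (f : 𝒜 M r) (c : Coord p q) (z : jetDomain M r) :
    ContDiffAt ℝ ∞ (slice f.1 c z) (z.1 c) := by
  obtain ⟨f, S, g, h⟩ := f
  refine ContDiffAt.congr_of_eventuallyEq ?_ (slice_eventuallyEq (fun z => (h z).2) c z)
  have h1 : ContDiff ℝ ∞ (fun s : ℝ => fun d : S => Function.update z.1 c s d.1) := by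
    rw [contDiff_pi]
    intro d
    by_cases hd : d.1 = c
    · simpa [hd] using contDiff_fun_id
    · simpa [hd] using contDiff_const
  refine ContDiffAt.comp (z.1 c) ?_ h1.contDiffAt
  simpa using (h z).1

theorem hasDerivAt_slice (f : 𝒜 M r) (c : Coord p q) (z : jetDomain M r) :
    HasDerivAt (slice f.1 c z) ((pderiv c f).1 z) (z.1 c) :=
  ((contDiffAt_slice f c z).differentiableAt (by simp)).hasDerivAt

/-- Only the values near `z` matter, so `φ` has to match `f` just where the line stays inside the
domain. -/
theorem pderiv_apply_eq {f : 𝒜 M r} {c : Coord p q} {z : jetDomain M r} {φ : ℝ → ℝ} {a : ℝ}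
    (h : HasDerivAt φ a (z.1 c))
    (hφ : ∀ s, ∀ hs : Function.update z.1 c s ∈ jetDomain M r, f.1 ⟨_, hs⟩ = φ s) :
    (pderiv c f).1 z = a := by
  refine (hasDerivAt_slice f c z).unique (h.congr_of_eventuallyEq ?_)
  filter_upwards [eventually_update_mem c z] with s hs
  rw [slice_apply _ _ _ hs, hφ]

/-- The partial derivative `∂/∂c`, as a derivation of `𝒜`. -/
def partialD (c : Coord p q) : Derivation ℝ (𝒜 M r) (𝒜 M r) :=
  Derivation.mk'
    { toFun := pderiv c
      map_add' := fun f g => Subtype.ext <| funext fun z =>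
        pderiv_apply_eq ((hasDerivAt_slice f c z).add (hasDerivAt_slice g c z)) fun s hs => by
          simp [slice_apply _ _ _ hs]
      map_smul' := fun a f => Subtype.ext <| funext fun z =>
        pderiv_apply_eq ((hasDerivAt_slice f c z).const_mul a) fun s hs => by
          simp [slice_apply _ _ _ hs] }
    fun f g => Subtype.ext <| funext fun z =>
      (pderiv_apply_eq ((hasDerivAt_slice f c z).mul (hasDerivAt_slice g c z)) fun s hs => by
          simp [slice_apply _ _ _ hs]).trans <| by
        simp [slice_self, mul_comm, add_comm]

theorem partialD_apply (c : Coord p q) (f : 𝒜 M r) : partialD c f = pderiv c f := rfl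

theorem pderiv_zero (c : Coord p q) : pderiv c (0 : 𝒜 M r) = 0 := (partialD c).map_zero

theorem two_le_infty : (2 : ℕ∞ω) ≤ ∞ :=
  WithTop.coe_le_coe.2 (le_top : (2 : ℕ∞) ≤ ⊤)

theorem pderiv_comm (c d : Coord p q) (f : 𝒜 M r) :
    pderiv c (pderiv d f) = pderiv d (pderiv c f) := by
  obtain ⟨f, S, g, h⟩ := f
  refine Subtype.ext (funext fun z => ?_)
  have key : ∀ c d : Coord p q, rawPartial c (rawPartial d f) z =
      fderiv ℝ (fderiv ℝ g) (fun c => z.1 c.1) (fun e => if e.1 = c then 1 else 0)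
        (fun e => if e.1 = d then 1 else 0) := by
    intro c d
    have hs : ∀ z : jetDomain M r, ContDiffAt ℝ ∞ (fderiv ℝ g) (fun c => z.1 c.1) := fun z =>
      (h z).1.fderiv_right (m := ∞) (by simp)
    rw [rawPartial_eq (S := S) (g := fun w => fderiv ℝ g w (fun e => if e.1 = d then 1 else 0))
      (fun z => ⟨(hs z).clm_apply contDiffAt_const, rawPartial_eq h d z⟩)]
    rw [fderiv_clm_apply ((hs z).differentiableAt (by simp)) (differentiableAt_const _)]
    simp
  change rawPartial c (rawPartial d f) z = rawPartial d (rawPartial c f) z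
  rw [key, key]
  exact (h z).1.isSymmSndFDerivAt (by simpa using two_le_infty) _ _

theorem pderiv_coordFun (c d : Coord p q) :
    pderiv c (coordFun d : 𝒜 M r) = if d = c then 1 else 0 := by
  refine Subtype.ext (funext fun z => ?_)
  by_cases h : d = c
  · subst h
    rw [if_pos rfl]
    exact pderiv_apply_eq (hasDerivAt_id' _) fun s hs => by simp [coordFun]
  · rw [if_neg h]
    exact pderiv_apply_eq (hasDerivAt_const _ (z.1 d)) fun s hs => by simp [coordFun, h]

/-! ### Vector fields on the jet space -/

theorem finite_support_mul_pderiv (v : Coord p q → 𝒜 M r) (f : 𝒜 M r) :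
    Function.HasFiniteSupport fun c => v c * pderiv c f :=
  (finite_pderiv_ne_zero f).subset fun c hc h => hc (by simp [h])

/-- The vector field `∑_c v_c ∂/∂c`, as a derivation of `𝒜`. -/
def field (v : Coord p q → 𝒜 M r) : Derivation ℝ (𝒜 M r) (𝒜 M r) :=
  Derivation.mk'
    { toFun := fun f => ∑ᶠ c, v c * pderiv c f
      map_add' := fun f g => by
        rw [← finsum_add_distrib (finite_support_mul_pderiv v f) (finite_support_mul_pderiv v g)]
        exact finsum_congr fun c => by rw [← partialD_apply, map_add, mul_add]; rfl
      map_smul' := fun a f => by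
        rw [RingHom.id_apply, smul_finsum' a (finite_support_mul_pderiv v f)]
        exact finsum_congr fun c => by
          rw [← partialD_apply, Derivation.map_smul, mul_smul_comm]; rfl }
    fun f g => by
      simp only [LinearMap.coe_mk, AddHom.coe_mk]
      rw [smul_finsum' f (finite_support_mul_pderiv v g),
        smul_finsum' g (finite_support_mul_pderiv v f), ← finsum_add_distrib]
      · refine finsum_congr fun c => ?_
        rw [← partialD_apply, Derivation.leibniz]
        simp only [partialD_apply, smul_eq_mul]
        ring
      · exact (finite_pderiv_ne_zero g).subset fun c hc h => hc (by simp [h])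
      · exact (finite_pderiv_ne_zero f).subset fun c hc h => hc (by simp [h])

theorem field_apply (v : Coord p q → 𝒜 M r) (f : 𝒜 M r) :
    field v f = ∑ᶠ c, v c * pderiv c f := rfl

theorem field_coordFun (v : Coord p q → 𝒜 M r) (d : Coord p q) : field v (coordFun d) = v d := by
  rw [field_apply, finsum_eq_single _ d]
  · simp [pderiv_coordFun]
  · intro c hc
    simp [pderiv_coordFun, hc.symm]

theorem field_add (v w : Coord p q → 𝒜 M r) (f : 𝒜 M r) :
    field (v + w) f = field v f + field w f := by
  simp only [field_apply]
  rw [← finsum_add_distrib (finite_support_mul_pderiv v f) (finite_support_mul_pderiv w f)]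
  exact finsum_congr fun c => by simp [add_mul]

/-- The commutator of two vector fields. -/
theorem field_commutator (v w : Coord p q → 𝒜 M r) (f : 𝒜 M r) :
    field v (field w f) - field w (field v f) =
      field (fun c => field v (w c) - field w (v c)) f := by
  have key : ∀ v w : Coord p q → 𝒜 M r, field v (field w f) =
      ∑ c ∈ (finite_pderiv_ne_zero f).toFinset, (field v (w c) * pderiv c f +
        ∑ d ∈ (finite_pderiv_ne_zero f).toFinset, v d * w c * pderiv c (pderiv d f)) := by
    intro v w
    rw [field_apply w f, finsum_eq_sum_of_support_subset (s := (finite_pderiv_ne_zero f).toFinset),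
      map_sum]
    · refine Finset.sum_congr rfl fun c _ => ?_
      rw [Derivation.leibniz, smul_eq_mul, smul_eq_mul, add_comm, mul_comm (pderiv c f)]
      congr 1
      -- Since partial derivatives commute, `∂_d ∂_c f` vanishes whenever `∂_d f` does, so one
      -- finite set of coordinates serves for both sums.
      rw [field_apply, finsum_eq_sum_of_support_subset
        (s := (finite_pderiv_ne_zero f).toFinset), Finset.mul_sum]
      · exact Finset.sum_congr rfl fun d _ => by rw [pderiv_comm d c]; ring
      · intro d hd
        simp only [Set.Finite.coe_toFinset, Set.mem_ofPred_eq]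
        exact fun h => hd (by simp only [pderiv_comm d c, h, pderiv_zero, mul_zero])
    · intro d hd
      simp only [Set.Finite.coe_toFinset, Set.mem_ofPred_eq]
      exact fun h => hd (by simp only [h, mul_zero])
  rw [key v w, key w v, field_apply, finsum_eq_sum_of_support_subset
    (s := (finite_pderiv_ne_zero f).toFinset)]
  · simp only [Finset.sum_add_distrib, sub_mul, Finset.sum_sub_distrib]
    -- The second-order parts of the two compositions agree by symmetry of second derivatives.
    have : ∑ c ∈ (finite_pderiv_ne_zero f).toFinset, ∑ d ∈ (finite_pderiv_ne_zero f).toFinset,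
        v d * w c * pderiv c (pderiv d f) = ∑ c ∈ (finite_pderiv_ne_zero f).toFinset,
        ∑ d ∈ (finite_pderiv_ne_zero f).toFinset, w d * v c * pderiv c (pderiv d f) := by
      rw [Finset.sum_comm]
      refine Finset.sum_congr rfl fun c _ => Finset.sum_congr rfl fun d _ => ?_
      rw [pderiv_comm]; ring
    rw [this]; ring
  · intro d hd
    simp only [Set.Finite.coe_toFinset, Set.mem_ofPred_eq]
    exact fun h => hd (by simp only [h, mul_zero])

/-- A commutator of fields is again a field, hence zero once its coefficients are. -/
theorem field_comm {v w : Coord p q → 𝒜 M r} (h : ∀ c, field v (w c) = field w (v c))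
    (f : 𝒜 M r) : field v (field w f) = field w (field v f) := by
  rw [← sub_eq_zero, field_commutator, field_apply]
  simp [h]

/-- The vector field whose only nonzero coefficients are the given coefficients of `∂/∂u^α_J`. -/
def vertCoeff (v : Lab p q → 𝒜 M r) : Coord p q → 𝒜 M r
  | .x _ => 0
  | .u α J => v (α, J)
  | .eps => 0

theorem Lab.u_injective : Function.Injective (Lab.u : Lab p q → Coord p q) := by
  rintro ⟨α, J⟩ ⟨β, K⟩ h
  simpa [Lab.u] using h

theorem field_vertCoeff (v : Lab p q → 𝒜 M r) (f : 𝒜 M r) :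
    field (vertCoeff v) f = ∑ᶠ c : Lab p q, v c * pderiv c.u f := by
  rw [field_apply, ← finsum_mem_univ]
  rw [finsum_mem_inter_support_eq _ _ (Set.range Lab.u), finsum_mem_range Lab.u_injective]
  · rfl
  · ext c
    simp only [Set.mem_inter_iff, Set.mem_univ, true_and, Set.mem_range, Function.mem_support]
    refine ⟨fun h => ⟨?_, h⟩, fun h => h.2⟩
    cases c with
    | x i => simp [vertCoeff] at h
    | u α J => exact ⟨(α, J), rfl⟩
    | eps => simp [vertCoeff] at h

theorem finite_pderiv_u_ne_zero (f : 𝒜 M r) : {c : Lab p q | pderiv c.u f ≠ 0}.Finite :=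
  (finite_pderiv_ne_zero f).preimage Lab.u_injective.injOn

/-- The coefficients of the vector field `D_i`. -/
def totalCoeff (M : BaseDomain p q) (r : ℝ) (i : Fin p) : Coord p q → 𝒜 M r
  | .x j => if j = i then 1 else 0
  | .u α J => coordFun (Lab.incr i (α, J)).u
  | .eps => 0

theorem totalDeriv_eq_field (i : Fin p) (f : 𝒜 M r) :
    totalDeriv i f = field (totalCoeff M r i) f := by
  have : totalCoeff M r i = (fun c : Coord p q => if c = .x i then 1 else 0) +
      vertCoeff fun c => coordFun (c.incr i).u := by
    funext c
    cases c <;> simp [totalCoeff, vertCoeff, eq_comm]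
  rw [this, field_add, field_vertCoeff, totalDeriv, field_apply, finsum_eq_single _ (Coord.x i)]
  · simp
  · intro c hc
    simp [hc]

/-- The total derivative, as a derivation of `𝒜`. -/
def totalD (i : Fin p) : Derivation ℝ (𝒜 M r) (𝒜 M r) := field (totalCoeff M r i)

theorem totalDeriv_eq :
    (totalDeriv : Fin p → 𝒜 M r → 𝒜 M r) = fun i => ⇑(totalD i : Derivation ℝ (𝒜 M r) (𝒜 M r)) :=
  funext fun i => funext (totalDeriv_eq_field i)

theorem totalD_u (i : Fin p) (c : Lab p q) :
    totalD i (coordFun c.u : 𝒜 M r) = coordFun (c.incr i).u := field_coordFun _ _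

theorem Lab.incr_comm (i j : Fin p) (c : Lab p q) : (c.incr i).incr j = (c.incr j).incr i := by
  simp [Lab.incr, add_right_comm]

theorem totalD_comm (i j : Fin p) (f : 𝒜 M r) : totalD i (totalD j f) = totalD j (totalD i f) := by
  refine field_comm (fun c => ?_) f
  change totalD i _ = totalD j _
  cases c with
  | x k => simp only [totalCoeff]; split_ifs <;> simp
  | u α J => simp only [totalCoeff, totalD_u, Lab.incr_comm]
  | eps => simp [totalCoeff]

/-! ### Iterated operators -/

theorem MultiIndex.induction {P : MultiIndex p → Prop} (h0 : P 0)
    (h1 : ∀ i J, P J → P (J + Finsupp.single i 1)) (J : MultiIndex p) : P J := by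
  obtain ⟨n, hn⟩ : ∃ n, J.degree = n := ⟨_, rfl⟩
  induction n generalizing J with
  | zero => rwa [(Finsupp.degree_eq_zero_iff J).1 hn]
  | succ n ih =>
    obtain ⟨i, hi⟩ : ∃ i, J i ≠ 0 := by
      by_contra! h
      rw [show J = 0 from Finsupp.ext h] at hn
      simp at hn
    have hJ : J - Finsupp.single i 1 + Finsupp.single i 1 = J :=
      tsub_add_cancel_of_le (Finsupp.single_le_iff.2 (Nat.one_le_iff_ne_zero.2 hi))
    rw [← hJ] at hn ⊢
    exact h1 i _ (ih _ (by simpa using hn))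

theorem iterOp_zero {V : Type*} (T : Fin p → V → V) (v : V) : iterOp T 0 v = v := by
  unfold iterOp
  induction List.finRange p with
  | nil => rfl
  | cons a l ih => simp

theorem iterOp_add_single {V : Type*} {T : Fin p → V → V}
    (hT : ∀ i j v, T i (T j v) = T j (T i v)) (J : MultiIndex p) (i : Fin p) (v : V) :
    iterOp T (J + Finsupp.single i 1) v = T i (iterOp T J v) := by
  -- Generalized to duplicate-free lists: the extra factor `T i` occurs only if `i` is in the list,
  -- and then at most once.
  have key : ∀ l : List (Fin p), l.Nodup →
      l.foldr (fun k w => (T k)^[(J + Finsupp.single i 1 : MultiIndex p) k] w) v =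
        if i ∈ l then T i (l.foldr (fun k w => (T k)^[J k] w) v)
          else l.foldr (fun k w => (T k)^[J k] w) v := by
    intro l hl
    induction l with
    | nil => simp
    | cons a l ih =>
      have hal := (List.nodup_cons.1 hl).1
      rw [List.foldr_cons, List.foldr_cons, ih (List.nodup_cons.1 hl).2]
      by_cases h : a = i
      · subst h
        simp [hal, Function.iterate_succ_apply']
      · have hc : ∀ n w, (T a)^[n] (T i w) = T i ((T a)^[n] w) := fun n w =>
          (Function.Commute.iterate_left (fun w => hT a i w) n).eq w
        by_cases h' : i ∈ l
        · simp [h', hc, Ne.symm h]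
        · simp [h', Ne.symm h]
  have := key (List.finRange p) (List.nodup_finRange p)
  simpa [iterOp] using this

theorem iterOp_semiconj {V W : Type*} {T : Fin p → V → V} {T' : Fin p → W → W}
    {φ : V → W} (h : ∀ i v, φ (T i v) = T' i (φ v)) (J : MultiIndex p) (v : V) :
    φ (iterOp T J v) = iterOp T' J (φ v) := by
  unfold iterOp
  induction List.finRange p with
  | nil => rfl
  | cons i l ih =>
    rw [List.foldr_cons, List.foldr_cons, ← ih]
    exact (Function.Semiconj.iterate_right (f := φ) (h i) (J i)).eq _

/-- `D_J`, as a linear map. -/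
def totalDJ (J : MultiIndex p) : 𝒜 M r →ₗ[ℝ] 𝒜 M r where
  toFun := iterOp totalDeriv J
  map_add' f g := by
    rw [totalDeriv_eq]
    induction J using MultiIndex.induction with
    | h0 => simp [iterOp_zero]
    | h1 i J ih => simp only [iterOp_add_single totalD_comm, ih, map_add]
  map_smul' a f := by
    rw [totalDeriv_eq]
    induction J using MultiIndex.induction with
    | h0 => simp [iterOp_zero]
    | h1 i J ih => simp only [iterOp_add_single totalD_comm, ih, Derivation.map_smul, RingHom.id_apply]

theorem totalDJ_apply (J : MultiIndex p) (f : 𝒜 M r) :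
    totalDJ J f = iterOp (fun i => totalD i) J f := by
  rw [← totalDeriv_eq]; rfl

theorem iterOp_totalDeriv (J : MultiIndex p) (f : 𝒜 M r) :
    iterOp totalDeriv J f = totalDJ J f := rfl

theorem totalDJ_zero (f : 𝒜 M r) : totalDJ 0 f = f := iterOp_zero _ _

theorem totalDJ_add_single (J : MultiIndex p) (i : Fin p) (f : 𝒜 M r) :
    totalDJ (J + Finsupp.single i 1) f = totalD i (totalDJ J f) := by
  rw [totalDJ_apply, totalDJ_apply, iterOp_add_single totalD_comm]

theorem map_totalDJ {φ : 𝒜 M r → 𝒜 M r} (h : ∀ i f, φ (totalD i f) = totalD i (φ f))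
    (J : MultiIndex p) (f : 𝒜 M r) : φ (totalDJ J f) = totalDJ J (φ f) := by
  rw [totalDJ_apply, totalDJ_apply]
  exact iterOp_semiconj h J f

theorem totalDJ_totalD (J : MultiIndex p) (i : Fin p) (f : 𝒜 M r) :
    totalDJ J (totalD i f) = totalD i (totalDJ J f) :=
  (map_totalDJ (fun j g => totalD_comm i j g) J f).symm

/-! ### The ideal of `o(ε^N)` functions -/

theorem update_eps_mem (z : jetDomain M r) {s : ℝ} (hs : s ∈ Set.Ioo (-r) r) :
    Function.update z.1 .eps s ∈ jetDomain M r := by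
  refine ⟨?_, by simpa using hs⟩
  simpa [Function.update_of_ne] using z.2.1

theorem pos_of_jetDomain (z : jetDomain M r) : 0 < r := by
  have := z.2.2
  linarith [this.1, this.2]

theorem zero_mem_Ioo (z : jetDomain M r) : (0 : ℝ) ∈ Set.Ioo (-r) r := by
  have := pos_of_jetDomain z
  constructor <;> linarith

theorem slice_update_eps (f : jetDomain M r → ℝ) (z : jetDomain M r) {s : ℝ}
    (hs : s ∈ Set.Ioo (-r) r) :
    slice f .eps ⟨_, update_eps_mem z hs⟩ = slice f .eps z := by
  funext t
  simp [slice]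

theorem contDiffOn_slice_eps (f : 𝒜 M r) (z : jetDomain M r) :
    ContDiffOn ℝ ∞ (slice f.1 .eps z) (Set.Ioo (-r) r) := by
  intro s hs
  have := contDiffAt_slice f .eps ⟨_, update_eps_mem z hs⟩
  rw [slice_update_eps f.1 z hs] at this
  simpa using this.contDiffWithinAt

theorem iteratedDerivWithin_slice_eps (f : 𝒜 M r) (z : jetDomain M r) (k : ℕ) {s : ℝ}
    (hs : s ∈ Set.Ioo (-r) r) :
    iteratedDerivWithin k (slice f.1 .eps z) (Set.Ioo (-r) r) s =
      slice ((pderiv .eps)^[k] f).1 .eps z s := by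
  induction k generalizing s with
  | zero => simp
  | succ k ih =>
    rw [iteratedDerivWithin_succ, derivWithin_congr (fun t ht => ih ht) (ih hs),
      derivWithin_of_isOpen isOpen_Ioo hs, Function.iterate_succ_apply']
    have := hasDerivAt_slice ((pderiv .eps)^[k] f) .eps ⟨_, update_eps_mem z hs⟩
    rw [slice_update_eps _ z hs] at this
    simp only [Function.update_self] at this
    rw [this.deriv, slice_apply _ _ _ (update_eps_mem z hs)]

/-- By Taylor's formula in `ε`, smallness along every `ε`-line is the vanishing of the coefficients
of orders `0, …, N`. Unlike a pointwise `o`-estimate, this form can be differentiated in the other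
coordinates. -/
theorem isSmall_iff {N : ℕ} {f : 𝒜 M r} : IsSmall N f ↔
    ∀ k ≤ N, ∀ z : jetDomain M r, z.1 .eps = 0 → ((pderiv .eps)^[k] f).1 z = 0 := by
  have taylor : ∀ (z : jetDomain M r) (n : ℕ), (∀ k < n, iteratedDerivWithin k (slice f.1 .eps z)
      (Set.Ioo (-r) r) 0 = 0) → (fun x => slice f.1 .eps z x - (n.factorial : ℝ)⁻¹ * x ^ n *
        iteratedDerivWithin n (slice f.1 .eps z) (Set.Ioo (-r) r) 0) =o[𝓝 0] fun x => x ^ n := by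
    intro z n hn
    have h := taylor_isLittleO (n := n) (convex_Ioo (-r) r) (zero_mem_Ioo z)
      ((contDiffOn_slice_eps f z).of_le (by exact_mod_cast le_top))
    rw [isOpen_Ioo.nhdsWithin_eq (zero_mem_Ioo z)] at h
    simp only [sub_zero] at h
    refine h.congr_left fun x => ?_
    rw [taylor_within_apply, Finset.sum_range_succ, Finset.sum_eq_zero]
    · simp
    · intro k hk
      rw [hn k (Finset.mem_range.1 hk), smul_zero]
  constructor
  · intro h k
    induction k using Nat.strong_induction_on with
    | _ k ih =>
      intro hk z hz
      have h0 : ∀ j, iteratedDerivWithin j (slice f.1 .eps z) (Set.Ioo (-r) r) 0 =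
          ((pderiv .eps)^[j] f).1 z := fun j => by
        rw [iteratedDerivWithin_slice_eps f z j (zero_mem_Ioo z)]
        have := slice_self ((pderiv .eps)^[j] f).1 .eps z
        rwa [hz] at this
      have h1 := taylor z k fun j hj => by rw [h0, ih j hj (by omega) z hz]
      have h2 : slice f.1 .eps z =o[𝓝 0] fun x => x ^ k := by
        refine (h z).trans_isBigO ?_
        obtain ⟨m, rfl⟩ := Nat.exists_eq_add_of_le hk
        simp_rw [pow_add]
        have : (fun e : ℝ => e ^ m) =O[𝓝 0] fun _ => (1 : ℝ) :=
          (continuous_pow m).continuousAt.isBigO_one ℝ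
        simpa using (Asymptotics.isBigO_refl (fun e : ℝ => e ^ k) (𝓝 0)).mul this
      have h3 := h2.sub h1
      simp only [sub_sub_cancel, h0] at h3
      -- Dividing by `x ^ k` away from `0` leaves a constant which is `o(1)`, so it vanishes.
      have h4 : (fun _ : ℝ => (k.factorial : ℝ)⁻¹ * ((pderiv .eps)^[k] f).1 z) =o[𝓝[≠] 0]
          fun _ => (1 : ℝ) := by
        have h5 := (h3.mono (nhdsWithin_le_nhds (s := {0}ᶜ))).mul_isBigO
          (Asymptotics.isBigO_refl (fun x : ℝ => (x ^ k)⁻¹) (𝓝[≠] 0))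
        refine h5.congr' ?_ ?_ <;>
        · filter_upwards [self_mem_nhdsWithin] with x hx
          have : x ^ k ≠ 0 := pow_ne_zero _ hx
          field_simp
      rw [Asymptotics.isLittleO_const_const_iff] at h4
      have : (k.factorial : ℝ)⁻¹ ≠ 0 := by positivity
      simpa [this] using h4
  · intro h z
    have h0 : ∀ j ≤ N, iteratedDerivWithin j (slice f.1 .eps z) (Set.Ioo (-r) r) 0 = 0 :=
      fun j hj => by
        rw [iteratedDerivWithin_slice_eps f z j (zero_mem_Ioo z),
          slice_apply _ _ _ (update_eps_mem z (zero_mem_Ioo z))]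
        exact h j hj _ (by simp)
    simpa [h0 N le_rfl] using taylor z N fun j hj => h0 j hj.le

/-- The `ε`-derivatives vanish on the hyperplane `ε = 0`, and moving along `c ≠ ε` stays inside it.
-/
theorem IsSmall.pderiv {N : ℕ} {f : 𝒜 M r} (h : IsSmall N f) {c : Coord p q} (hc : c ≠ .eps) :
    IsSmall N (pderiv c f) := by
  rw [isSmall_iff] at h ⊢
  intro k hk z hz
  have hcomm : ∀ g : 𝒜 M r, (ApproxHam.pderiv .eps)^[k] (ApproxHam.pderiv c g) =
      ApproxHam.pderiv c ((ApproxHam.pderiv .eps)^[k] g) := fun g =>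
    (Function.Commute.iterate_left (fun w => pderiv_comm .eps c w) k).eq g
  rw [hcomm]
  refine pderiv_apply_eq (hasDerivAt_const _ (0 : ℝ)) fun s hs => h k hk _ ?_
  simpa [Function.update_of_ne hc.symm] using hz

theorem eventually_slice_eps (f : jetDomain M r → ℝ) (z : jetDomain M r) :
    ∀ᶠ s in 𝓝 (0 : ℝ), ∃ h, slice f .eps z s = f ⟨Function.update z.1 .eps s, h⟩ := by
  filter_upwards [isOpen_Ioo.mem_nhds (zero_mem_Ioo z)] with s hs
  exact ⟨update_eps_mem z hs, slice_apply _ _ _ _⟩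

/-- The ideal of the differential functions which are `o(ε^N)`. -/
def smallIdeal (M : BaseDomain p q) (r : ℝ) (N : ℕ) : Ideal (𝒜 M r) where
  carrier := {f | IsSmall N f}
  zero_mem' z := by
    refine (Asymptotics.isLittleO_zero _ _).congr' ?_ Filter.EventuallyEq.rfl
    filter_upwards [eventually_slice_eps (0 : 𝒜 M r).1 z] with s ⟨h, hs⟩
    rw [hs]; rfl
  add_mem' {f g} hf hg z := by
    refine ((hf z).add (hg z)).congr' ?_ Filter.EventuallyEq.rfl
    filter_upwards [isOpen_Ioo.mem_nhds (zero_mem_Ioo z)] with s hs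
    simp [slice_apply _ _ _ (update_eps_mem z hs)]
  smul_mem' g f hf z := by
    have hg : slice g.1 .eps z =O[𝓝 0] fun _ => (1 : ℝ) :=
      (((contDiffOn_slice_eps g z).continuousOn.continuousAt
        (isOpen_Ioo.mem_nhds (zero_mem_Ioo z)))).isBigO_one ℝ
    have := hg.mul_isLittleO (hf z)
    simp only [one_mul] at this
    refine this.congr' ?_ Filter.EventuallyEq.rfl
    filter_upwards [isOpen_Ioo.mem_nhds (zero_mem_Ioo z)] with s hs
    simp [slice_apply _ _ _ (update_eps_mem z hs)]

theorem mem_smallIdeal {N : ℕ} {f : 𝒜 M r} : f ∈ smallIdeal M r N ↔ IsSmall N f := Iff.rfl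

/-- An ideal which is stable under the partial derivatives other than `∂/∂ε`. -/
def IsJetIdeal (I : Ideal (𝒜 M r)) : Prop :=
  ∀ c : Coord p q, c ≠ .eps → ∀ f ∈ I, pderiv c f ∈ I

theorem isJetIdeal_bot : IsJetIdeal (⊥ : Ideal (𝒜 M r)) := by
  rintro c - f rfl
  exact pderiv_zero c

theorem isJetIdeal_smallIdeal (N : ℕ) : IsJetIdeal (smallIdeal M r N) :=
  fun _ hc _ hf => IsSmall.pderiv hf hc

/-- A component along `∂/∂ε` has to be excluded: it would lower the order of smallness. -/
theorem IsJetIdeal.field_mem {I : Ideal (𝒜 M r)} (hI : IsJetIdeal I) {v : Coord p q → 𝒜 M r}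
    (hv : v .eps = 0) {f : 𝒜 M r} (hf : f ∈ I) : field v f ∈ I := by
  rw [field_apply]
  refine finsum_induction (· ∈ I) I.zero_mem (fun _ _ => I.add_mem) fun c => ?_
  by_cases hc : c = .eps
  · simp [hc, hv]
  · exact I.mul_mem_left _ (hI c hc f hf)

theorem IsJetIdeal.totalD_mem {I : Ideal (𝒜 M r)} (hI : IsJetIdeal I) (i : Fin p) {f : 𝒜 M r}
    (hf : f ∈ I) : totalD i f ∈ I := hI.field_mem rfl hf

theorem IsJetIdeal.totalDJ_mem {I : Ideal (𝒜 M r)} (hI : IsJetIdeal I) (J : MultiIndex p)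
    {f : 𝒜 M r} (hf : f ∈ I) : totalDJ J f ∈ I := by
  induction J using MultiIndex.induction with
  | h0 => rwa [totalDJ_zero]
  | h1 i J ih => rw [totalDJ_add_single]; exact hI.totalD_mem i ih

/-! ### Functionals modulo a differential ideal -/

theorem divergence_eq (X : Fin p → 𝒜 M r) : divergence X = ∑ i, totalD i (X i) := by
  simp [divergence, totalDeriv_eq]

/-- The densities of the functionals which vanish modulo the ideal `I`. -/
def nullDensities (I : Ideal (𝒜 M r)) : Submodule ℝ (𝒜 M r) where
  carrier := {L | ∃ X : Fin p → 𝒜 M r, L - divergence X ∈ I}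
  zero_mem' := ⟨0, by simp [divergence_eq]⟩
  add_mem' := by
    rintro L L' ⟨X, hX⟩ ⟨X', hX'⟩
    refine ⟨X + X', ?_⟩
    convert I.add_mem hX hX' using 1
    simp only [divergence_eq, Pi.add_apply, map_add, Finset.sum_add_distrib]
    abel
  smul_mem' := by
    rintro a L ⟨X, hX⟩
    refine ⟨a • X, ?_⟩
    convert I.smul_of_tower_mem a hX using 1
    simp only [divergence_eq, Pi.smul_apply, Derivation.map_smul, smul_sub, Finset.smul_sum]

/-- The functional with the given density, modulo the ideal `I`. -/
def integral (I : Ideal (𝒜 M r)) : 𝒜 M r →ₗ[ℝ] 𝒜 M r ⧸ nullDensities I := (nullDensities I).mkQ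

theorem integral_eq_zero {I : Ideal (𝒜 M r)} {L : 𝒜 M r} :
    integral I L = 0 ↔ ∃ X : Fin p → 𝒜 M r, L - divergence X ∈ I :=
  Submodule.Quotient.mk_eq_zero _

theorem integralZero_iff {L : 𝒜 M r} : IntegralZero L ↔ integral ⊥ L = 0 := by
  simp [integral_eq_zero, IntegralZero, sub_eq_zero]

theorem integralSmall_iff {N : ℕ} {L : 𝒜 M r} :
    IntegralSmall N L ↔ integral (smallIdeal M r N) L = 0 := by
  simp [integral_eq_zero, IntegralSmall, mem_smallIdeal]

theorem integral_of_mem {I : Ideal (𝒜 M r)} {L : 𝒜 M r} (h : L ∈ I) : integral I L = 0 :=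
  integral_eq_zero.2 ⟨0, by simpa [divergence_eq] using h⟩

theorem integral_totalD (I : Ideal (𝒜 M r)) (i : Fin p) (f : 𝒜 M r) :
    integral I (totalD i f) = 0 := by
  refine integral_eq_zero.2 ⟨Pi.single i f, ?_⟩
  rw [divergence_eq, Finset.sum_eq_single i (fun j _ hj => by simp [hj]) (by simp)]
  simp

theorem integral_totalD_mul (I : Ideal (𝒜 M r)) (i : Fin p) (f g : 𝒜 M r) :
    integral I (totalD i f * g) = - integral I (f * totalD i g) := by
  have := integral_totalD I i (f * g)
  rw [Derivation.leibniz, map_add, smul_eq_mul, smul_eq_mul, mul_comm g] at this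
  exact eq_neg_of_add_eq_zero_right this

/-- `(-D)_J`, the formal adjoint of `D_J`. -/
def adjDJ (J : MultiIndex p) : 𝒜 M r →ₗ[ℝ] 𝒜 M r :=
  (-1 : ℝ) ^ J.degree • (totalDJ J : 𝒜 M r →ₗ[ℝ] 𝒜 M r)

theorem adjDJ_apply (J : MultiIndex p) (f : 𝒜 M r) :
    adjDJ J f = (-1 : ℝ) ^ J.degree • totalDJ J f := rfl

theorem adjDJ_totalD (J : MultiIndex p) (i : Fin p) (f : 𝒜 M r) :
    adjDJ J (totalD i f) = totalD i (adjDJ J f) := by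
  rw [adjDJ_apply, adjDJ_apply, totalDJ_totalD, Derivation.map_smul]

theorem adjDJ_zero (f : 𝒜 M r) : adjDJ 0 f = f := by simp [adjDJ, totalDJ_zero]

theorem adjDJ_add_single (J : MultiIndex p) (i : Fin p) (f : 𝒜 M r) :
    adjDJ (J + Finsupp.single i 1) f = - totalD i (adjDJ J f) := by
  simp [adjDJ, totalDJ_add_single, pow_add, Derivation.map_smul]

theorem IsJetIdeal.adjDJ_mem {I : Ideal (𝒜 M r)} (hI : IsJetIdeal I) (J : MultiIndex p)
    {f : 𝒜 M r} (hf : f ∈ I) : adjDJ J f ∈ I :=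
  I.smul_of_tower_mem ((-1 : ℝ) ^ J.degree) (hI.totalDJ_mem J hf)

theorem integral_totalDJ_mul (I : Ideal (𝒜 M r)) (J : MultiIndex p) (f g : 𝒜 M r) :
    integral I (totalDJ J f * g) = integral I (f * adjDJ J g) := by
  induction J using MultiIndex.induction generalizing g with
  | h0 => simp [totalDJ_zero, adjDJ_zero]
  | h1 i J ih =>
    rw [totalDJ_add_single, integral_totalD_mul, ih, adjDJ_add_single, adjDJ_totalD, ← map_neg]
    congr 1
    ring

/-! ### Prolonged evolutionary vector fields and the Euler operator -/

/-- The prolonged evolutionary vector field `pr v_V`. -/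
def prEv (V : Fin q → 𝒜 M r) : Derivation ℝ (𝒜 M r) (𝒜 M r) :=
  field (vertCoeff fun c => totalDJ c.2 (V c.1))

theorem prEv_apply (V : Fin q → 𝒜 M r) (f : 𝒜 M r) :
    prEv V f = ∑ᶠ c : Lab p q, totalDJ c.2 (V c.1) * pderiv c.u f := field_vertCoeff _ _

/-- It suffices to compare on coordinates; on `u^α_J` both sides give `D_{J,i} V_α`. -/
theorem prEv_totalD (V : Fin q → 𝒜 M r) (i : Fin p) (f : 𝒜 M r) :
    prEv V (totalD i f) = totalD i (prEv V f) := by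
  refine field_comm (fun c => ?_) f
  cases c with
  | x j => simp only [totalCoeff, vertCoeff]; split_ifs <;> simp
  | u α J =>
    simp only [totalCoeff, vertCoeff, field_coordFun, Lab.u, Lab.incr, totalDJ_add_single]
    rfl
  | eps => simp [totalCoeff, vertCoeff]

theorem prEv_totalDJ (V : Fin q → 𝒜 M r) (J : MultiIndex p) (f : 𝒜 M r) :
    prEv V (totalDJ J f) = totalDJ J (prEv V f) :=
  map_totalDJ (prEv_totalD V) J f

theorem IsJetIdeal.prEv_mem {I : Ideal (𝒜 M r)} (hI : IsJetIdeal I) (V : Fin q → 𝒜 M r)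
    {f : 𝒜 M r} (hf : f ∈ I) : prEv V f ∈ I := hI.field_mem rfl hf

/-- Commuting with every `D_i`, the field sends divergences to divergences; it also preserves `I`.
Thus it acts on functionals modulo `I`. -/
theorem IsJetIdeal.integral_prEv {I : Ideal (𝒜 M r)} (hI : IsJetIdeal I) (V : Fin q → 𝒜 M r)
    {f : 𝒜 M r} (hf : integral I f = 0) : integral I (prEv V f) = 0 := by
  obtain ⟨X, hX⟩ := integral_eq_zero.1 hf
  refine integral_eq_zero.2 ⟨fun i => prEv V (X i), ?_⟩
  have := hI.prEv_mem V hX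
  rw [divergence_eq, map_sub, map_sum] at this
  simpa only [divergence_eq, prEv_totalD] using this

theorem prEv_commutator (V W : Fin q → 𝒜 M r) (f : 𝒜 M r) :
    prEv V (prEv W f) - prEv W (prEv V f) = prEv (fun α => prEv V (W α) - prEv W (V α)) f := by
  refine (field_commutator _ _ f).trans ?_
  rw [prEv]
  congr 2
  funext c
  cases c with
  | x j => simp [vertCoeff]
  | u α J =>
    simp only [vertCoeff, map_sub, ← prEv_totalDJ]
    rfl
  | eps => simp [vertCoeff]

theorem neg_one_pow_mul (n : ℕ) (f : 𝒜 M r) : (-1 : 𝒜 M r) ^ n * f = (-1 : ℝ) ^ n • f := by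
  induction n with
  | zero => simp
  | succ n ih =>
    rw [pow_succ (-1 : ℝ), mul_neg_one, neg_smul, ← ih]
    ring

theorem euler_eq (L : 𝒜 M r) (α : Fin q) :
    euler L α = ∑ᶠ J : MultiIndex p, adjDJ J (pderiv (.u α J) L) := by
  refine finsum_congr fun J => ?_
  rw [iterOp_totalDeriv, adjDJ_apply]
  exact neg_one_pow_mul _ _

/-- The multi-indices of the derivatives of the `u^α` on which `f` depends. -/
def jetSupport (f : 𝒜 M r) : Finset (MultiIndex p) :=
  (finite_pderiv_u_ne_zero f).toFinset.image Prod.snd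

theorem mem_jetSupport {f : 𝒜 M r} {α : Fin q} {J : MultiIndex p} (h : pderiv (.u α J) f ≠ 0) :
    J ∈ jetSupport f :=
  Finset.mem_image.2 ⟨(α, J), by simpa [Lab.u] using h, rfl⟩

theorem euler_eq_sum (L : 𝒜 M r) (α : Fin q) :
    euler L α = ∑ J ∈ jetSupport L, adjDJ J (pderiv (.u α J) L) := by
  rw [euler_eq]
  refine finsum_eq_sum_of_support_subset _ fun J hJ => mem_jetSupport (α := α) fun h => hJ ?_
  simp [h]

theorem prEv_eq_sum (V : Fin q → 𝒜 M r) (L : 𝒜 M r) :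
    prEv V L = ∑ α, ∑ J ∈ jetSupport L, totalDJ J (V α) * pderiv (.u α J) L := by
  rw [prEv_apply, finsum_eq_sum_of_support_subset (s := Finset.univ ×ˢ jetSupport L),
    Finset.sum_product]
  · rfl
  · rintro ⟨α, J⟩ hJ
    simp only [Finset.coe_product, Set.mem_prod, Finset.coe_univ, Set.mem_univ, true_and]
    exact mem_jetSupport (α := α) fun h => hJ (by simp [Lab.u, h])

/-- The first variation formula: integration by parts moves each `D_J` off `V`. -/
theorem integral_sum_mul_euler (I : Ideal (𝒜 M r)) (V : Fin q → 𝒜 M r) (L : 𝒜 M r) :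
    integral I (∑ α, V α * euler L α) = integral I (prEv V L) := by
  simp only [prEv_eq_sum, euler_eq_sum, Finset.mul_sum, map_sum, integral_totalDJ_mul]

/-- The Fréchet derivative of a variational derivative is self-adjoint. -/
theorem IsJetIdeal.integral_mul_prEv_euler {I : Ideal (𝒜 M r)} (hI : IsJetIdeal I)
    (V W : Fin q → 𝒜 M r) (L : 𝒜 M r) :
    integral I (∑ α, W α * prEv V (euler L α)) = integral I (∑ α, V α * prEv W (euler L α)) := by
  -- The second variation, obtained by differentiating the first variation formula for `W` along
  -- `V`.
  have key : ∀ V W : Fin q → 𝒜 M r, integral I (prEv V (prEv W L)) =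
      integral I (∑ α, prEv V (W α) * euler L α) + integral I (∑ α, W α * prEv V (euler L α)) := by
    intro V W
    have h1 : integral I (prEv W L - ∑ α, W α * euler L α) = 0 := by
      rw [map_sub, integral_sum_mul_euler, sub_self]
    have h2 := hI.integral_prEv V h1
    rw [map_sub, map_sub, sub_eq_zero] at h2
    rw [h2, map_sum, ← map_add, ← Finset.sum_add_distrib]
    congr 1
    refine Finset.sum_congr rfl fun α _ => ?_
    rw [Derivation.leibniz, smul_eq_mul, smul_eq_mul]
    ring
  -- The commutator is evolutionary with characteristic `V(W) - W(V)`; it accounts exactly for the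
  -- terms in which the characteristics are differentiated.
  have h := congrArg (integral I) (prEv_commutator V W L)
  rw [map_sub, key V W, key W V, ← integral_sum_mul_euler] at h
  simp only [sub_mul, Finset.sum_sub_distrib, map_sub] at h
  linear_combination (norm := module) h

/-- Among the coefficients of `D_i` only that of `∂/∂u^α_{J-i}`, namely `u^α_J`, depends on `u^α_J`.
The case `J i = 0` is split off because subtraction of multi-indices is truncated. -/
theorem pderiv_totalD (α : Fin q) (J : MultiIndex p) (i : Fin p) (f : 𝒜 M r) :
    pderiv (.u α J) (totalD i f) = totalD i (pderiv (.u α J) f) +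
      if J i = 0 then 0 else pderiv (.u α (J - Finsupp.single i 1)) f := by
  have hp : ∀ g : 𝒜 M r, pderiv (.u α J) g = field (Pi.single (Coord.u α J) (1 : 𝒜 M r)) g := fun g => by
    rw [field_apply, finsum_eq_single _ (Coord.u α J) fun c hc => by simp [hc]]
    simp
  have h := field_commutator (Pi.single (Coord.u α J) (1 : 𝒜 M r)) (totalCoeff M r i) f
  rw [← hp, ← hp, sub_eq_iff_eq_add] at h
  refine h.trans ?_
  rw [add_comm]
  congr 1
  have hz : ∀ c : Coord p q, field (totalCoeff M r i)
      ((Pi.single (Coord.u α J) (1 : 𝒜 M r) : Coord p q → 𝒜 M r) c) = 0 := fun c => by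
    by_cases hc : c = .u α J
    · subst hc; simp
    · simp [hc]
  simp only [hz, ← hp, sub_zero]
  have hc : ∀ (β : Fin q) (K : MultiIndex p), pderiv (.u α J) (totalCoeff M r i (.u β K)) =
      if β = α ∧ K + Finsupp.single i 1 = J then 1 else 0 := fun β K => by
    simp [totalCoeff, Lab.u, Lab.incr, pderiv_coordFun]
  have hx : ∀ c : Coord p q, pderiv (.u α J) (totalCoeff M r i c) ≠ 0 →
      J i ≠ 0 ∧ c = .u α (J - Finsupp.single i 1) := by
    intro c h
    cases c with
    | x j =>
      refine absurd ?_ h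
      simp only [totalCoeff, ← partialD_apply]
      split_ifs <;> simp
    | u β K =>
      rw [hc, ne_eq, ite_eq_right_iff, Classical.not_imp] at h
      obtain ⟨⟨rfl, rfl⟩, -⟩ := h
      simp
    | eps => simp [totalCoeff, pderiv_zero] at h
  split_ifs with hJ
  · refine finsum_eq_zero_of_forall_eq_zero fun c => ?_
    by_contra h
    exact (hx c (left_ne_zero_of_mul h)).1 hJ
  · rw [field_apply, finsum_eq_single _ (Coord.u α (J - Finsupp.single i 1))]
    · have : J - Finsupp.single i 1 + Finsupp.single i 1 = J :=
        tsub_add_cancel_of_le (Finsupp.single_le_iff.2 (Nat.one_le_iff_ne_zero.2 hJ))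
      rw [hc, if_pos ⟨rfl, this⟩, one_mul]
    · intro c hc
      by_contra h
      exact hc (hx c (left_ne_zero_of_mul h)).2

/-- The two terms of `[∂/∂u^α_J, D_i]` cancel after a shift of `J`, because `(-D)_{J,i} = -D_i
(-D)_J`. -/
theorem euler_totalD (i : Fin p) (f : 𝒜 M r) (α : Fin q) : euler (totalD i f) α = 0 := by
  have hfin : {J : MultiIndex p | pderiv (.u α J) f ≠ 0}.Finite :=
    (jetSupport f).finite_toSet.subset fun J hJ => mem_jetSupport hJ
  have h1 : Function.HasFiniteSupport fun J : MultiIndex p =>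
      adjDJ J (totalD i (pderiv (.u α J) f)) :=
    hfin.subset fun J hJ h => hJ (by simp [h])
  have h2 : Function.HasFiniteSupport fun J : MultiIndex p => adjDJ J
      (if J i = 0 then 0 else pderiv (.u α (J - Finsupp.single i 1)) f) := by
    refine (hfin.image (· + Finsupp.single i 1)).subset fun J hJ => ?_
    have hJi : J i ≠ 0 := fun h => hJ (by simp [h])
    refine ⟨J - Finsupp.single i 1, fun h => hJ (by simp [h]), ?_⟩
    exact tsub_add_cancel_of_le (Finsupp.single_le_iff.2 (Nat.one_le_iff_ne_zero.2 hJi))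
  rw [euler_eq]
  simp only [pderiv_totalD, map_add]
  rw [finsum_add_distrib h1 h2]
  have h3 : ∑ᶠ J : MultiIndex p, adjDJ J
      (if J i = 0 then 0 else pderiv (.u α (J - Finsupp.single i 1)) f) =
      ∑ᶠ J : MultiIndex p, - adjDJ J (totalD i (pderiv (.u α J) f)) := by
    -- Indices with `J i = 0` contribute nothing, so the sum runs over the shifts `J + e_i`.
    rw [← finsum_mem_univ, finsum_mem_inter_support_eq _ _
      (Set.range fun J : MultiIndex p => J + Finsupp.single i 1),
      finsum_mem_range (add_left_injective _)]
    · refine finsum_congr fun J => ?_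
      rw [adjDJ_totalD, ← adjDJ_add_single]
      simp
    · ext J
      simp only [Set.mem_inter_iff, Set.mem_univ, true_and, Function.mem_support]
      refine ⟨fun h => ⟨⟨J - Finsupp.single i 1, ?_⟩, h⟩, fun h => h.2⟩
      have hJi : J i ≠ 0 := fun h' => h (by simp [h'])
      exact tsub_add_cancel_of_le (Finsupp.single_le_iff.2 (Nat.one_le_iff_ne_zero.2 hJi))
  rw [h3, finsum_neg_distrib, add_neg_cancel]

/-- The Euler operator, as a linear map. -/
def eulerL (α : Fin q) : 𝒜 M r →ₗ[ℝ] 𝒜 M r where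
  toFun L := euler L α
  map_add' L L' := by
    simp only [euler_eq, ← partialD_apply, map_add]
    refine finsum_add_distrib ?_ ?_
    · exact (jetSupport L).finite_toSet.subset fun J hJ => mem_jetSupport (α := α) fun h =>
        hJ (by simp [partialD_apply, h])
    · exact (jetSupport L').finite_toSet.subset fun J hJ => mem_jetSupport (α := α) fun h =>
        hJ (by simp [partialD_apply, h])
  map_smul' a L := by
    simp only [euler_eq, ← partialD_apply, Derivation.map_smul, map_smul, RingHom.id_apply]
    rw [smul_finsum' a]
    exact (jetSupport L).finite_toSet.subset fun J hJ => mem_jetSupport (α := α) fun h =>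
      hJ (by simp [partialD_apply, h])

theorem eulerL_apply (α : Fin q) (L : 𝒜 M r) : eulerL α L = euler L α := rfl

/-- The Euler operator kills divergences and maps `I` into itself. -/
theorem IsJetIdeal.euler_mem {I : Ideal (𝒜 M r)} (hI : IsJetIdeal I) {L : 𝒜 M r}
    (hL : integral I L = 0) (α : Fin q) : euler L α ∈ I := by
  obtain ⟨X, hX⟩ := integral_eq_zero.1 hL
  have h1 : euler L α = euler (L - divergence X) α := by
    rw [← eulerL_apply, ← eulerL_apply, map_sub, divergence_eq, map_sum]
    simp [eulerL_apply, euler_totalD]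
  rw [h1, euler_eq_sum]
  exact I.sum_mem fun J _ => hI.adjDJ_mem J (hI _ (by simp) _ hX)

/-! ### Test functions -/

theorem totalD_x (i j : Fin p) :
    totalD i (coordFun (.x j) : 𝒜 M r) = if j = i then 1 else 0 := field_coordFun _ _

/-- The commutation rule `[D_J, x^i] = J_i D_{J-i}`. If `J i = 0`, the factor `J i` removes the
meaningless truncated term. -/
theorem totalDJ_x_mul (J : MultiIndex p) (i : Fin p) (f : 𝒜 M r) :
    totalDJ J (coordFun (.x i) * f) =
      coordFun (.x i) * totalDJ J f + (J i : ℝ) • totalDJ (J - Finsupp.single i 1) f := by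
  induction J using MultiIndex.induction with
  | h0 => simp [totalDJ_zero]
  | h1 j J ih =>
    rw [totalDJ_add_single, ih, map_add, Derivation.leibniz, Derivation.map_smul, totalD_x,
      smul_eq_mul, smul_eq_mul, ← totalDJ_add_single, add_assoc]
    congr 1
    by_cases h : i = j
    · subst h
      rw [if_pos rfl, mul_one, add_tsub_cancel_right]
      rcases Nat.eq_zero_or_pos (J i) with h0 | h0
      · simp [h0]
      · have : J - Finsupp.single i 1 + Finsupp.single i 1 = J :=
          tsub_add_cancel_of_le (Finsupp.single_le_iff.2 h0)
        rw [← totalDJ_add_single, this, Finsupp.add_apply, Finsupp.single_eq_same, Nat.cast_add,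
          add_smul, Nat.cast_one, one_smul, add_comm]
    · rw [if_neg h, mul_zero, zero_add, ← totalDJ_add_single]
      have h1 : (J + Finsupp.single j 1 : MultiIndex p) i = J i := by
        simp [Ne.symm h]
      have h2 : J + Finsupp.single j 1 - Finsupp.single i 1 =
          J - Finsupp.single i 1 + Finsupp.single j 1 := by
        ext k
        simp only [Finsupp.add_apply, Finsupp.tsub_apply, Finsupp.single_apply]
        split_ifs with h2 h3 <;> simp_all
      rw [h1, h2]

/-- Differential functions which do not depend on the jet variables. -/
def IsBaseFunction (f : 𝒜 M r) : Prop := ∀ c : Lab p q, pderiv c.u f = 0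

theorem isBaseFunction_one : IsBaseFunction (1 : 𝒜 M r) := fun c => (partialD c.u).map_one_eq_zero

theorem IsBaseFunction.x_mul {f : 𝒜 M r} (hf : IsBaseFunction f) (i : Fin p) :
    IsBaseFunction (coordFun (.x i) * f) := fun c => by
  rw [← partialD_apply, Derivation.leibniz, partialD_apply, partialD_apply, hf c, pderiv_coordFun]
  simp [Lab.u]

/-- If a sum of bilinear expressions `G J (a J) φ` of order `J` in the base function `φ` always
lies in an ideal, then so do the coefficients `a J`. -/
theorem coeff_mem_of_forall_base {I : Ideal (𝒜 M r)}
    {G : MultiIndex p → 𝒜 M r →ₗ[ℝ] 𝒜 M r →ₗ[ℝ] 𝒜 M r} (h0 : ∀ a f, G 0 a f = a * f)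
    (hx : ∀ J a i f, G J a (coordFun (.x i) * f) =
      coordFun (.x i) * G J a f + (J i : ℝ) • G (J - Finsupp.single i 1) a f)
    (hI : ∀ J, ∀ a ∈ I, ∀ f, G J a f ∈ I) {a : MultiIndex p →₀ 𝒜 M r}
    (ha : ∀ φ, IsBaseFunction φ → (a.sum fun J c => G J c φ) ∈ I) (J : MultiIndex p) :
    a J ∈ I := by
  -- Induction on a strict bound for the order of the expression.
  obtain ⟨n, hn⟩ : ∃ n, ∀ J, a J ≠ 0 → J.degree < n :=
    ⟨a.support.sup Finsupp.degree + 1, fun J hJ =>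
      Nat.lt_succ_of_le (Finset.le_sup (f := Finsupp.degree) (Finsupp.mem_support_iff.2 hJ))⟩
  induction n generalizing a J with
  | zero =>
    by_contra h
    exact absurd (hn J fun h' => h (h' ▸ I.zero_mem)) (by simp)
  | succ n ih =>
    have hpos : ∀ i J, a (J + Finsupp.single i 1) ∈ I := by
      intro i J
      -- The coefficients of the commutator with multiplication by `x^i`. Its order is lower by one
      -- and it still takes values in `I`, since `x^i φ` is again a base function.
      set b : MultiIndex p →₀ 𝒜 M r :=
        a.sum fun J c => Finsupp.single (J - Finsupp.single i 1) ((J i : ℝ) • c) with hb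
      have hbK : ∀ K, b K = ((K i + 1 : ℕ) : ℝ) • a (K + Finsupp.single i 1) := by
        intro K
        rw [hb, Finsupp.sum_apply, Finsupp.sum, Finset.sum_eq_single (K + Finsupp.single i 1)]
        · simp
        · intro J _ hJK
          rw [Finsupp.single_apply]
          split_ifs with hJ
          · rcases Nat.eq_zero_or_pos (J i) with h | h
            · simp [h]
            · refine absurd ?_ hJK
              rw [← hJ]
              exact (tsub_add_cancel_of_le (Finsupp.single_le_iff.2 h)).symm
          · rfl
        · intro h
          simp [Finsupp.notMem_support_iff.1 h]
      have hsum : ∀ φ, (b.sum fun J c => G J c φ) =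
          (a.sum fun J c => G J c (coordFun (.x i) * φ)) -
            coordFun (.x i) * a.sum fun J c => G J c φ := by
        intro φ
        rw [hb, Finsupp.sum_sum_index (by simp) (by simp), Finsupp.mul_sum, ← Finsupp.sum_sub]
        refine Finsupp.sum_congr fun J _ => ?_
        rw [Finsupp.sum_single_index (by simp), hx]
        simp
      have := ih (a := b) (fun φ hφ => by
        rw [hsum]
        exact I.sub_mem (ha _ (hφ.x_mul i)) (I.mul_mem_left _ (ha φ hφ))) J (fun K hK => by
        rw [hbK] at hK
        have := hn _ (right_ne_zero_of_smul hK)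
        simpa using this)
      rw [hbK] at this
      have h1 := I.smul_of_tower_mem (((J i + 1 : ℕ) : ℝ)⁻¹) this
      rwa [smul_smul, inv_mul_cancel₀ (by positivity), one_smul] at h1
    have hne : ∀ J, J ≠ 0 → a J ∈ I := by
      intro J
      induction J using MultiIndex.induction with
      | h0 => intro h; exact absurd rfl h
      | h1 i J _ => intro _; exact hpos i J
    by_cases hJ : J = 0
    · subst hJ
      -- All coefficients of positive order are in `I` by now; the test function `1` isolates the
      -- one of order zero.
      have h1 := ha 1 isBaseFunction_one
      by_cases ha0 : a 0 = 0
      · rw [ha0]; exact I.zero_mem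
      · rw [Finsupp.sum, ← Finset.add_sum_erase _ _ (Finsupp.mem_support_iff.2 ha0), h0,
          mul_one] at h1
        refine (I.add_mem_iff_left (I.sum_mem fun K hK => ?_)).1 h1
        exact hI K _ (hne K (Finset.ne_of_mem_erase hK)) _
    · exact hne J hJ

theorem IsJetIdeal.coeff_mem_left {I : Ideal (𝒜 M r)} {a : MultiIndex p →₀ 𝒜 M r}
    (ha : ∀ φ, IsBaseFunction φ → (a.sum fun J c => c * totalDJ J φ) ∈ I) (J : MultiIndex p) :
    a J ∈ I := by
  refine coeff_mem_of_forall_base (G := fun J => (LinearMap.mul ℝ (𝒜 M r)).compl₂ (totalDJ J))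
    (fun a f => by simp [totalDJ_zero]) (fun J a i f => ?_) (fun J a ha f => ?_) ha J
  · simp only [LinearMap.compl₂_apply, LinearMap.mul_apply', totalDJ_x_mul, mul_add,
      mul_smul_comm, mul_left_comm]
  · exact I.mul_mem_right _ ha

/-- The variant with coefficients inside the derivatives, the shape in which the Euler operator
produces them. -/
theorem IsJetIdeal.coeff_mem_right {I : Ideal (𝒜 M r)} (hI : IsJetIdeal I)
    {a : MultiIndex p →₀ 𝒜 M r}
    (ha : ∀ φ, IsBaseFunction φ → (a.sum fun J c => totalDJ J (c * φ)) ∈ I) (J : MultiIndex p) :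
    a J ∈ I := by
  refine coeff_mem_of_forall_base (G := fun J => (LinearMap.mul ℝ (𝒜 M r)).compr₂ (totalDJ J))
    (fun a f => by simp [totalDJ_zero]) (fun J a i f => ?_) (fun J a ha f => ?_) ha J
  · simp only [LinearMap.compr₂_apply, LinearMap.mul_apply', ← totalDJ_x_mul, mul_left_comm]
  · exact hI.totalDJ_mem J (I.mul_mem_right _ ha)

/-- The Euler operator turns the hypothesis into `∑_J (-D)_J (φ ∂h/∂u^α_J) ∈ I` for all base
functions `φ`, and the coefficients can be read off. -/
theorem IsJetIdeal.pderiv_mem_of_integral {I : Ideal (𝒜 M r)} (hI : IsJetIdeal I) {h : 𝒜 M r}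
    (hh : ∀ φ, IsBaseFunction φ → integral I (φ * h) = 0) (α : Fin q) (J : MultiIndex p) :
    pderiv (.u α J) h ∈ I := by
  have hfin : (Function.support fun J : MultiIndex p =>
      (-1 : ℝ) ^ J.degree • pderiv (.u α J) h).Finite :=
    (jetSupport h).finite_toSet.subset fun J hJ => mem_jetSupport (α := α) fun h' =>
      hJ (by simp [h'])
  have key := hI.coeff_mem_right (a := Finsupp.ofSupportFinite _ hfin) (fun φ hφ => by
    have h1 := hI.euler_mem (hh φ hφ) α
    rw [euler_eq] at h1
    convert h1 using 1
    rw [Finsupp.sum, finsum_eq_sum_of_support_subset]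
    · refine Finset.sum_congr rfl fun J _ => ?_
      rw [adjDJ_apply, ← partialD_apply, Derivation.leibniz, partialD_apply, partialD_apply,
        show pderiv (.u α J) φ = 0 from hφ (α, J)]
      have h2 : (Finsupp.ofSupportFinite _ hfin) J =
        (-1 : ℝ) ^ J.degree • pderiv (.u α J) h := rfl
      rw [h2, smul_zero, add_zero, smul_mul_assoc, map_smul, smul_eq_mul, mul_comm φ]
    · intro J hJ
      rw [Finset.mem_coe, Finsupp.mem_support_iff]
      intro h'
      have h2 : pderiv (.u α J) h = 0 := by
        have h3 : (-1 : ℝ) ^ J.degree • pderiv (.u α J) h = 0 := h'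
        exact (smul_eq_zero_iff_right (pow_ne_zero _ (by norm_num))).1 h3
      refine hJ ?_
      simp only
      rw [← partialD_apply, Derivation.leibniz, partialD_apply, partialD_apply,
        show pderiv (.u α J) φ = 0 from hφ (α, J), h2]
      simp) J
  have h1 := I.smul_of_tower_mem ((-1 : ℝ) ^ J.degree) key
  have h2 : (Finsupp.ofSupportFinite _ hfin) J = (-1 : ℝ) ^ J.degree • pderiv (.u α J) h := rfl
  rwa [h2, smul_smul, ← mul_pow, neg_one_mul, neg_neg, one_pow, one_smul] at h1

/-- The fundamental lemma of the calculus of variations, with test functions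
`φ(x)` and `φ(x) u^α`. -/
theorem IsJetIdeal.mem_of_integral {I : Ideal (𝒜 M r)} (hI : IsJetIdeal I) {h : 𝒜 M r}
    (α : Fin q) (h1 : ∀ φ, IsBaseFunction φ → integral I (φ * h) = 0)
    (h2 : ∀ φ, IsBaseFunction φ → integral I (φ * coordFun (.u α 0) * h) = 0) : h ∈ I := by
  have h3 := hI.pderiv_mem_of_integral h1 α 0
  -- The test functions `φ` alone cannot see the part of `h` free of jet variables. Applied to `u^α
  -- h`, the Leibniz rule gives `u^α ∂h/∂u^α + h ∈ I`, which isolates `h`.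
  have h4 := hI.pderiv_mem_of_integral (h := coordFun (.u α 0) * h)
    (fun φ hφ => by rw [← mul_assoc]; exact h2 φ hφ) α 0
  rw [← partialD_apply, Derivation.leibniz, partialD_apply, partialD_apply, pderiv_coordFun,
    if_pos rfl, smul_eq_mul, smul_eq_mul, mul_one] at h4
  exact (I.add_mem_iff_right (I.mul_mem_left _ h3)).1 h4

/-! ### Test characteristics that are variational derivatives. -/

theorem euler_eq_single {L f : 𝒜 M r} {α : Fin q}
    (h : ∀ c : Lab p q, pderiv c.u L = if c = (α, 0) then f else 0) :
    euler L = Pi.single α f := by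
  funext β
  rw [euler_eq, finsum_eq_single _ (0 : MultiIndex p), adjDJ_zero]
  · rw [show (Coord.u β 0 : Coord p q) = Lab.u (β, 0) from rfl, h]
    by_cases hβ : β = α
    · subst hβ; simp
    · simp [hβ]
  · intro J hJ
    rw [show (Coord.u β J : Coord p q) = Lab.u (β, J) from rfl, h, if_neg (by simp [hJ]), map_zero]

theorem exists_euler_eq_single_base {φ : 𝒜 M r} (hφ : IsBaseFunction φ) (α : Fin q) :
    ∃ L : 𝒜 M r, euler L = Pi.single α φ := by
  refine ⟨φ * coordFun (.u α 0), euler_eq_single fun c => ?_⟩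
  rw [← partialD_apply, Derivation.leibniz, partialD_apply, partialD_apply, hφ c, pderiv_coordFun]
  have : (Coord.u α 0 = c.u) ↔ c = (α, 0) := by
    rw [show (Coord.u α 0 : Coord p q) = Lab.u (α, 0) from rfl, Lab.u_injective.eq_iff, eq_comm]
  simp [this]

theorem exists_euler_eq_single_base_mul {φ : 𝒜 M r} (hφ : IsBaseFunction φ) (α : Fin q) :
    ∃ L : 𝒜 M r, euler L = Pi.single α (φ * coordFun (.u α 0)) := by
  refine ⟨(1 / 2 : ℝ) • (φ * (coordFun (.u α 0) * coordFun (.u α 0))),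
    euler_eq_single fun c => ?_⟩
  rw [← partialD_apply, Derivation.map_smul, Derivation.leibniz, Derivation.leibniz,
    partialD_apply, partialD_apply, hφ c, pderiv_coordFun]
  have : (Coord.u α 0 = c.u) ↔ c = (α, 0) := by
    rw [show (Coord.u α 0 : Coord p q) = Lab.u (α, 0) from rfl, Lab.u_injective.eq_iff, eq_comm]
  by_cases hc : c = (α, 0)
  · rw [if_pos (this.2 hc), if_pos hc]
    simp only [smul_eq_mul, mul_one, mul_zero, add_zero, mul_add]
    module
  · simp [this, hc]

/-! ### Operators and their adjoints -/

theorem MatDiffOp.apply_eq (D : MatDiffOp M r) (Q : Fin q → 𝒜 M r) (α : Fin q) :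
    D.apply Q α = ∑ β, (D α β).sum fun J P => P * totalDJ J (Q β) := rfl

theorem MatDiffOp.apply_add_op (D E : MatDiffOp M r) (Q : Fin q → 𝒜 M r) (α : Fin q) :
    MatDiffOp.apply (D + E) Q α = D.apply Q α + E.apply Q α := by
  simp only [MatDiffOp.apply_eq, Matrix.add_apply, ← Finset.sum_add_distrib]
  exact Finset.sum_congr rfl fun β _ => Finsupp.sum_add_index' (by simp) (by simp [add_mul])

theorem MatDiffOp.apply_smul_op (a : ℝ) (D : MatDiffOp M r) (Q : Fin q → 𝒜 M r) (α : Fin q) :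
    MatDiffOp.apply (a • D) Q α = a • D.apply Q α := by
  simp only [MatDiffOp.apply_eq, Matrix.smul_apply, Finset.smul_sum]
  refine Finset.sum_congr rfl fun β _ => ?_
  rw [Finsupp.sum_smul_index' (by simp), Finsupp.smul_sum]
  simp

theorem MatDiffOp.apply_neg_op (D : MatDiffOp M r) (Q : Fin q → 𝒜 M r) (α : Fin q) :
    MatDiffOp.apply (-D) Q α = - D.apply Q α := by
  have := MatDiffOp.apply_smul_op (-1) D Q α
  rw [neg_one_smul ℝ (D.apply Q α)] at this
  rw [← this]
  congr 1
  exact (neg_one_smul ℝ D).symm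

/-- `D` is skew-adjoint modulo `I`. -/
def SkewMod (I : Ideal (𝒜 M r)) (D : MatDiffOp M r) : Prop :=
  ∀ P Q : Fin q → 𝒜 M r,
    integral I (∑ α, P α * D.apply Q α) = - integral I (∑ α, Q α * D.apply P α)

theorem isSkewAdjoint_iff {D : MatDiffOp M r} : IsSkewAdjoint D ↔ SkewMod ⊥ D := by
  refine forall_congr' fun P => forall_congr' fun Q => ?_
  rw [integralZero_iff, map_sub, sub_eq_zero]
  simp only [MatDiffOp.apply_neg_op]
  have : ∑ α, Q α * -D.apply P α = - ∑ α, Q α * D.apply P α := by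
    rw [← Finset.sum_neg_distrib]
    exact Finset.sum_congr rfl fun α _ => by ring
  rw [this, map_neg]

theorem integral_eq_zero_of_bot {I : Ideal (𝒜 M r)} {L : 𝒜 M r} (h : integral ⊥ L = 0) :
    integral I L = 0 := by
  obtain ⟨X, hX⟩ := integral_eq_zero.1 h
  exact integral_eq_zero.2 ⟨X, bot_le (a := I) hX⟩

theorem SkewMod.of_bot {D : MatDiffOp M r} (h : SkewMod ⊥ D) (I : Ideal (𝒜 M r)) :
    SkewMod I D := fun P Q => by
  have h1 := h P Q
  rw [eq_neg_iff_add_eq_zero, ← map_add] at h1 ⊢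
  exact integral_eq_zero_of_bot h1

theorem SkewMod.add_smul {I : Ideal (𝒜 M r)} {D E : MatDiffOp M r} (hD : SkewMod I D)
    (hE : SkewMod I E) (a b : ℝ) : SkewMod I (a • D + b • E) := fun P Q => by
  simp only [MatDiffOp.apply_add_op, MatDiffOp.apply_smul_op, mul_add, mul_smul_comm,
    Finset.sum_add_distrib, ← Finset.smul_sum, map_add, map_smul, hD P Q, hE P Q]
  module

/-- The formal adjoint of the entry `(β, α)` of `D`. -/
def adjEntry (D : MatDiffOp M r) (α β : Fin q) (f : 𝒜 M r) : 𝒜 M r :=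
  (D β α).sum fun J c => adjDJ J (c * f)

theorem integral_sum_mul_apply (I : Ideal (𝒜 M r)) (D : MatDiffOp M r) (P Q : Fin q → 𝒜 M r) :
    integral I (∑ α, P α * D.apply Q α) = integral I (∑ α, Q α * ∑ β, adjEntry D α β (P β)) := by
  simp only [MatDiffOp.apply_eq, adjEntry, Finset.mul_sum, Finsupp.sum, map_sum]
  rw [Finset.sum_comm]
  refine Finset.sum_congr rfl fun β _ => Finset.sum_congr rfl fun α _ =>
    Finset.sum_congr rfl fun J _ => ?_
  rw [← integral_totalDJ_mul]
  congr 1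
  ring

/-- Scalar differential operators `∑_J a_J D_J`. -/
def IsDiffOp (T : 𝒜 M r → 𝒜 M r) : Prop :=
  ∃ a : MultiIndex p →₀ 𝒜 M r, ∀ f, T f = a.sum fun J c => c * totalDJ J f

theorem IsDiffOp.zero : IsDiffOp (fun _ => 0 : 𝒜 M r → 𝒜 M r) := ⟨0, by simp⟩

theorem IsDiffOp.add {T T' : 𝒜 M r → 𝒜 M r} (h : IsDiffOp T) (h' : IsDiffOp T') :
    IsDiffOp (fun f => T f + T' f) := by
  obtain ⟨a, ha⟩ := h
  obtain ⟨b, hb⟩ := h'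
  refine ⟨a + b, fun f => ?_⟩
  simp only [ha, hb]
  rw [Finsupp.sum_add_index' (by simp) (by simp [add_mul])]

theorem IsDiffOp.sum {ι : Type*} (s : Finset ι) {T : ι → 𝒜 M r → 𝒜 M r}
    (h : ∀ i ∈ s, IsDiffOp (T i)) : IsDiffOp (fun f => ∑ i ∈ s, T i f) := by
  classical
  induction s using Finset.induction_on with
  | empty => simpa using IsDiffOp.zero
  | insert i s hi ih =>
    simp only [Finset.sum_insert hi]
    exact (h i (by simp)).add (ih fun j hj => h j (by simp [hj]))

theorem IsDiffOp.mul_totalDJ (c : 𝒜 M r) (J : MultiIndex p) :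
    IsDiffOp (fun f => c * totalDJ J f) :=
  ⟨Finsupp.single J c, fun f => by rw [Finsupp.sum_single_index (by simp)]⟩

theorem IsDiffOp.totalD {T : 𝒜 M r → 𝒜 M r} (h : IsDiffOp T) (i : Fin p) :
    IsDiffOp (fun f => totalD i (T f)) := by
  obtain ⟨a, ha⟩ := h
  simp only [ha, Finsupp.sum, map_sum]
  refine IsDiffOp.sum _ fun J _ => ?_
  simp only [Derivation.leibniz, smul_eq_mul, ← totalDJ_add_single]
  refine (IsDiffOp.mul_totalDJ _ _).add ?_
  simp only [mul_comm (totalDJ J _)]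
  exact IsDiffOp.mul_totalDJ _ _

/-- Brings formal adjoints into the form `∑ a_J D_J`, so that `D + D*` has well-defined coefficients
to compare. -/
theorem IsDiffOp.adjDJ_mul (c : 𝒜 M r) (J : MultiIndex p) :
    IsDiffOp (fun f => adjDJ J (c * f)) := by
  induction J using MultiIndex.induction with
  | h0 => simpa [adjDJ_zero, totalDJ_zero] using IsDiffOp.mul_totalDJ c (0 : MultiIndex p)
  | h1 i J ih =>
    obtain ⟨a, ha⟩ := ih.totalD i
    refine ⟨-a, fun f => ?_⟩
    have h := ha f
    simp only at h ⊢
    rw [adjDJ_add_single, h, Finsupp.sum_neg_index (by simp), Finsupp.sum, Finsupp.sum,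
      ← Finset.sum_neg_distrib]
    exact Finset.sum_congr rfl fun J _ => by ring

theorem IsDiffOp.eq_zero {T : 𝒜 M r → 𝒜 M r} (h : IsDiffOp T)
    (h0 : ∀ φ, IsBaseFunction φ → T φ = 0) (f : 𝒜 M r) : T f = 0 := by
  obtain ⟨a, ha⟩ := h
  have : a = 0 := Finsupp.ext fun J =>
    IsJetIdeal.coeff_mem_left (I := ⊥) (fun φ hφ => by rw [← ha, h0 φ hφ]; exact zero_mem _) J
  rw [ha, this, Finsupp.sum_zero_index]

/-- The skew-symmetry of the bracket implies the skew-adjointness of the operator. -/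
theorem isSkewAdjoint_of_bracket {D : MatDiffOp M r}
    (h : ∀ P L : 𝒜 M r, IntegralZero (bracket D P L + bracket D L P)) : IsSkewAdjoint D := by
  -- The symmetrized bracket is `∫ δP · (D + D*) δL`.
  have hbr : ∀ P L : 𝒜 M r, integral ⊥
      (∑ α, euler P α * (D.apply (euler L) α + ∑ β, adjEntry D α β (euler L β))) = 0 := by
    intro P L
    have := integralZero_iff.1 (h P L)
    rw [map_add, bracket, bracket, integral_sum_mul_apply ⊥ D (euler L), ← map_add,
      ← Finset.sum_add_distrib] at this
    simpa only [mul_add] using this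
  have hop : ∀ α β, IsDiffOp fun f =>
      ((D α β).sum fun J P => P * totalDJ J f) + adjEntry D α β f := fun α β =>
    IsDiffOp.add (IsDiffOp.sum _ fun J _ => IsDiffOp.mul_totalDJ _ _)
      (IsDiffOp.sum _ fun J _ => IsDiffOp.adjDJ_mul _ _)
  have hsum : ∀ (Q : Fin q → 𝒜 M r) α, D.apply Q α + ∑ β, adjEntry D α β (Q β) =
      ∑ β, (((D α β).sum fun J P => P * totalDJ J (Q β)) + adjEntry D α β (Q β)) := by
    intro Q α
    rw [MatDiffOp.apply_eq, Finset.sum_add_distrib]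
  -- Each entry of `D + D*` kills base functions by the fundamental lemma, hence is the zero
  -- operator.
  have hzero : ∀ α β f, ((D α β).sum fun J P => P * totalDJ J f) + adjEntry D α β f = 0 := by
    intro α β
    refine (hop α β).eq_zero fun φ hφ => ?_
    obtain ⟨L, hL⟩ := exists_euler_eq_single_base hφ β
    have key : ∀ P (ψ : 𝒜 M r), euler P = Pi.single α ψ → integral ⊥
        (ψ * (((D α β).sum fun J P => P * totalDJ J φ) + adjEntry D α β φ)) = 0 := by
      intro P ψ hP
      have h1 := hbr P L
      rw [Finset.sum_eq_single α (fun γ _ hγ => by simp [hP, hγ]) (by simp), hsum,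
        Finset.sum_eq_single β (fun γ _ hγ => by simp [hL, hγ, adjEntry]) (by simp), hP, hL] at h1
      simpa using h1
    refine isJetIdeal_bot.mem_of_integral α (fun ψ hψ => ?_) (fun ψ hψ => ?_)
    · obtain ⟨P, hP⟩ := exists_euler_eq_single_base hψ α
      exact key P ψ hP
    · obtain ⟨P, hP⟩ := exists_euler_eq_single_base_mul hψ α
      exact key P _ hP
  rw [isSkewAdjoint_iff]
  intro P Q
  rw [eq_neg_iff_add_eq_zero, integral_sum_mul_apply ⊥ D Q P, ← map_add, ← Finset.sum_add_distrib]
  simp [← mul_add, hsum, hzero]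

/-! ### Multi-vectors -/

/-- The total derivative of multi-vectors, as a linear map. -/
def mvD (k : ℕ) (i : Fin p) : MultiVec M r k →ₗ[ℝ] MultiVec M r k where
  toFun := MultiVec.totalDeriv i
  map_add' η ξ := by
    refine Finsupp.sum_add_index' (fun a => ?_) (fun a P Q => ?_)
    · simp [totalDeriv_eq]
    · simp only [totalDeriv_eq, map_add, Finsupp.single_add, Finset.sum_add_distrib]
      abel
  map_smul' t η := by
    rw [RingHom.id_apply, MultiVec.totalDeriv, Finsupp.sum_smul_index' (by simp [totalDeriv_eq]),
      MultiVec.totalDeriv, Finsupp.smul_sum]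
    refine Finsupp.sum_congr fun a _ => ?_
    simp only [totalDeriv_eq, Derivation.map_smul, smul_add, Finset.smul_sum, Finsupp.smul_single]

theorem mvD_apply {k : ℕ} (i : Fin p) (η : MultiVec M r k) :
    mvD k i η = MultiVec.totalDeriv i η := rfl

theorem mvD_single {k : ℕ} (i : Fin p) (a : Fin k → Lab p q) (P : 𝒜 M r) :
    mvD k i (Finsupp.single a P) = Finsupp.single a (totalD i P) +
      ∑ s : Fin k, Finsupp.single (Function.update a s ((a s).incr i)) P := by
  rw [mvD_apply, MultiVec.totalDeriv, Finsupp.sum_single_index (by simp [totalDeriv_eq]),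
    totalDeriv_eq]

/-- The (non-antisymmetrized) evaluation of a `k`-vector on characteristics `P 0, …, P (k-1)`. -/
def pair {k : ℕ} (P : Fin k → Fin q → 𝒜 M r) : MultiVec M r k →ₗ[ℝ] 𝒜 M r where
  toFun η := η.sum fun a c => c * ∏ s, totalDJ (a s).2 (P s (a s).1)
  map_add' η ξ := Finsupp.sum_add_index' (by simp) (by simp [add_mul])
  map_smul' t η := by
    rw [RingHom.id_apply, Finsupp.sum_smul_index' (by simp), Finsupp.smul_sum]
    simp

theorem pair_apply {k : ℕ} (P : Fin k → Fin q → 𝒜 M r) (η : MultiVec M r k) :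
    pair P η = η.sum fun a c => c * ∏ s, totalDJ (a s).2 (P s (a s).1) := rfl

theorem pair_single {k : ℕ} (P : Fin k → Fin q → 𝒜 M r) (a : Fin k → Lab p q) (c : 𝒜 M r) :
    pair P (Finsupp.single a c) = c * ∏ s, totalDJ (a s).2 (P s (a s).1) := by
  rw [pair_apply, Finsupp.sum_single_index (by simp)]

theorem pair_mem {I : Ideal (𝒜 M r)} {k : ℕ} (P : Fin k → Fin q → 𝒜 M r) {η : MultiVec M r k}
    (h : ∀ a, η a ∈ I) : pair P η ∈ I :=
  I.sum_mem fun a _ => I.mul_mem_right _ (h a)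

theorem multiVec_induction {k : ℕ} {C : MultiVec M r k → Prop} (h0 : C 0)
    (h1 : ∀ η ξ, C η → C ξ → C (η + ξ)) (h2 : ∀ a c, C (Finsupp.single a c))
    (η : MultiVec M r k) : C η := Finsupp.induction_linear η h0 h1 h2

theorem totalD_prod (i : Fin p) {k : ℕ} (g : Fin k → Lab p q → 𝒜 M r)
    (hg : ∀ s c, totalD i (g s c) = g s (c.incr i)) (a : Fin k → Lab p q) :
    totalD i (∏ t, g t (a t)) = ∑ s, ∏ t, g t (Function.update a s ((a s).incr i) t) := by
  induction k with
  | zero => simp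
  | succ k ih =>
    rw [Fin.prod_univ_succ, Derivation.leibniz, ih (fun t => g t.succ) (fun s c => hg _ c)
      (fun t => a t.succ), hg, Fin.sum_univ_succ, smul_eq_mul, smul_eq_mul, add_comm]
    congr 1
    · rw [Fin.prod_univ_succ, mul_comm]
      simp
    · rw [Finset.mul_sum]
      refine Finset.sum_congr rfl fun s _ => ?_
      rw [Fin.prod_univ_succ]
      congr 1
      · simp [Function.update_apply]

/-- Evaluation replaces `θ^α_J` by `D_J P_α`, which obeys the same rule under `D_i`. Hence
divergences of multi-vectors evaluate to divergences. -/
theorem pair_mvD {k : ℕ} (i : Fin p) (P : Fin k → Fin q → 𝒜 M r) (η : MultiVec M r k) :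
    pair P (mvD k i η) = totalD i (pair P η) := by
  induction η using multiVec_induction with
  | h0 => simp
  | h1 η ξ h h' => rw [map_add, map_add, map_add, map_add, h, h']
  | h2 a c =>
    rw [mvD_single, map_add, map_sum]
    simp only [pair_single]
    rw [Derivation.leibniz, smul_eq_mul, smul_eq_mul, add_comm, mul_comm _ (totalD i c),
      totalD_prod i (fun s (d : Lab p q) => totalDJ d.2 (P s d.1)) (fun s d =>
        (totalDJ_add_single d.2 i _).symm), Finset.mul_sum]

/-- The antisymmetrization, `η ↦ ∑_σ sgn σ · (η ∘ σ)`. -/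
def altL (k : ℕ) : MultiVec M r k →ₗ[ℝ] MultiVec M r k where
  toFun η := ∑ σ : Equiv.Perm (Fin k), ((Equiv.Perm.sign σ : ℤ) : ℝ) •
    Finsupp.equivMapDomain (σ.arrowCongr (Equiv.refl (Lab p q))) η
  map_add' η ξ := by
    rw [← Finset.sum_add_distrib]
    refine Finset.sum_congr rfl fun σ _ => ?_
    ext1 a
    simp
  map_smul' t η := by
    rw [RingHom.id_apply, Finset.smul_sum]
    refine Finset.sum_congr rfl fun σ _ => ?_
    rw [smul_comm]
    ext1 a
    simp

theorem altL_eq {k : ℕ} (η : MultiVec M r k) : altL k η = ∑ σ : Equiv.Perm (Fin k),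
    ((Equiv.Perm.sign σ : ℤ) : ℝ) •
      Finsupp.equivMapDomain (σ.arrowCongr (Equiv.refl (Lab p q))) η := rfl

theorem altL_apply {k : ℕ} (η : MultiVec M r k) (a : Fin k → Lab p q) :
    altL k η a = altCoeff η a := by
  rw [altL_eq, Finsupp.finsetSum_apply]
  exact Finset.sum_congr rfl fun σ _ => Int.cast_smul_eq_zsmul ℝ _ _

theorem altL_single {k : ℕ} (a : Fin k → Lab p q) (c : 𝒜 M r) :
    altL k (Finsupp.single a c) = ∑ σ : Equiv.Perm (Fin k),
      ((Equiv.Perm.sign σ : ℤ) : ℝ) • Finsupp.single (a ∘ σ.symm) c := by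
  rw [altL_eq]
  simp only [Finsupp.equivMapDomain_single]
  rfl

/-- Permuting the labels of a monomial amounts to permuting the arguments. -/
theorem pair_altL {k : ℕ} (P : Fin k → Fin q → 𝒜 M r) (η : MultiVec M r k) :
    pair P (altL k η) = 
      ∑ σ : Equiv.Perm (Fin k), ((Equiv.Perm.sign σ : ℤ) : ℝ) • pair (P ∘ σ) η := by
  induction η using multiVec_induction with
  | h0 => simp
  | h1 η ξ h h' => simp only [map_add, h, h', smul_add, Finset.sum_add_distrib]
  | h2 a c =>
    rw [altL_single, map_sum]
    refine Finset.sum_congr rfl fun σ _ => ?_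
    rw [map_smul, pair_single, pair_single]
    congr 2
    rw [← Equiv.prod_comp σ]
    simp

theorem mvD_altL {k : ℕ} (i : Fin p) (η : MultiVec M r k) :
    altL k (mvD k i η) = mvD k i (altL k η) := by
  induction η using multiVec_induction with
  | h0 => simp
  | h1 η ξ h h' => rw [map_add, map_add, map_add, map_add, h, h']
  | h2 a c =>
    rw [mvD_single, map_add, map_sum, altL_single, altL_single, map_sum]
    simp only [altL_single]
    rw [Finset.sum_comm, ← Finset.sum_add_distrib]
    refine Finset.sum_congr rfl fun σ _ => ?_
    rw [map_smul, mvD_single, ← Finset.smul_sum, ← smul_add]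
    congr 2
    rw [← Equiv.sum_comp σ fun s => Finsupp.single
      (Function.update (a ∘ σ.symm) s (((a ∘ σ.symm) s).incr i)) c]
    refine Finset.sum_congr rfl fun s _ => ?_
    congr 1
    rw [Function.update_comp_equiv]
    simp

theorem altL_altL {k : ℕ} (η : MultiVec M r k) :
    altL k (altL k η) = (k.factorial : ℝ) • altL k η := by
  ext1 a
  rw [altL_apply, Finsupp.smul_apply, altL_apply, altCoeff]
  -- An antisymmetrized coefficient is alternating, so all `k!` summands coincide.
  have : ∀ τ : Equiv.Perm (Fin k), (Equiv.Perm.sign τ : ℤ) • altL k η (a ∘ τ) = altCoeff η a := by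
    intro τ
    rw [altL_apply, altCoeff, altCoeff, Finset.smul_sum, ← Equiv.sum_comp (Equiv.mulLeft τ)
      fun σ : Equiv.Perm (Fin k) => (Equiv.Perm.sign σ : ℤ) • η (a ∘ σ)]
    refine Finset.sum_congr rfl fun σ _ => ?_
    rw [smul_smul]
    simp [Function.comp_assoc]
  rw [Finset.sum_congr rfl fun τ _ => this τ, Finset.sum_const, Finset.card_univ,
    Fintype.card_perm, Fintype.card_fin, Nat.cast_smul_eq_nsmul]

/-- The total divergence of multi-vectors. -/
def mvDiv (k : ℕ) : (Fin p → MultiVec M r k) →ₗ[ℝ] MultiVec M r k :=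
  ∑ i, (mvD k i).comp (LinearMap.proj i)

theorem mvDiv_apply {k : ℕ} (X : Fin p → MultiVec M r k) : mvDiv k X = ∑ i, mvD k i (X i) := by
  simp [mvDiv]

theorem integral_pair_mvDiv (I : Ideal (𝒜 M r)) {k : ℕ} (P : Fin k → Fin q → 𝒜 M r)
    (X : Fin p → MultiVec M r k) : integral I (pair P (mvDiv k X)) = 0 := by
  simp [mvDiv_apply, pair_mvD, integral_totalD]

theorem altL_mvDiv {k : ℕ} (X : Fin p → MultiVec M r k) :
    altL k (mvDiv k X) = mvDiv k fun i => altL k (X i) := by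
  simp [mvDiv_apply, mvD_altL]

theorem integralSmall_multiVec_iff {N k : ℕ} {η : MultiVec M r k} :
    η.IntegralSmall N ↔ ∃ X, ∀ a, altL k (η + mvDiv k X) a ∈ smallIdeal M r N := by
  have h : ∀ (X : Fin p → MultiVec M r k) a, altCoeff (η - ∑ i, MultiVec.totalDeriv i (X i)) a =
      altL k (η + mvDiv k ((-1 : ℝ) • X)) a := by
    intro X a
    rw [altL_apply, altCoeff, altCoeff]
    refine Finset.sum_congr rfl fun σ _ => ?_
    rw [Finsupp.add_apply, Finsupp.sub_apply, map_smul, Finsupp.smul_apply, mvDiv_apply]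
    congr 1
    simp only [mvD_apply]
    module
  constructor
  · rintro ⟨X, hX⟩
    exact ⟨(-1 : ℝ) • X, fun a => by rw [← h]; exact hX a⟩
  · rintro ⟨X, hX⟩
    refine ⟨(-1 : ℝ) • X, fun a => ?_⟩
    rw [h, smul_smul, neg_one_mul, neg_neg, one_smul]
    exact hX a

theorem integral_pair_altL_eq_zero {I : Ideal (𝒜 M r)} {k : ℕ} {η : MultiVec M r k}
    (h : ∃ X, ∀ a, altL k (η + mvDiv k X) a ∈ I) (P : Fin k → Fin q → 𝒜 M r) :
    integral I (pair P (altL k η)) = 0 := by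
  obtain ⟨X, hX⟩ := h
  have := integral_of_mem (pair_mem P hX)
  rwa [map_add, map_add, map_add, altL_mvDiv, integral_pair_mvDiv, add_zero] at this

/-- `η ↦ θ_c ∧ η`. -/
def consL (k : ℕ) (c : Lab p q) : MultiVec M r k →ₗ[ℝ] MultiVec M r (k + 1) :=
  Finsupp.lmapDomain _ ℝ fun a => (Fin.cons c a : Fin (k + 1) → Lab p q)

theorem consL_single {k : ℕ} (c : Lab p q) (a : Fin k → Lab p q) (P : 𝒜 M r) :
    consL k c (Finsupp.single a P) = Finsupp.single (Fin.cons c a : Fin (k + 1) → Lab p q) P :=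
  Finsupp.mapDomain_single

theorem pair_consL {k : ℕ} (P : Fin q → 𝒜 M r) (G : Fin k → Fin q → 𝒜 M r) (c : Lab p q)
    (η : MultiVec M r k) : pair (Fin.cons P G : Fin (k + 1) → Fin q → 𝒜 M r) (consL k c η) =
      totalDJ c.2 (P c.1) * pair G η := by
  induction η using multiVec_induction with
  | h0 => simp
  | h1 η ξ h h' => rw [map_add, map_add, map_add, mul_add, h, h']
  | h2 a x =>
    rw [consL_single, pair_single, pair_single, Fin.prod_univ_succ]
    simp [mul_left_comm]

theorem mvD_consL {k : ℕ} (i : Fin p) (c : Lab p q) (η : MultiVec M r k) :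
    mvD (k + 1) i (consL k c η) = consL k (c.incr i) η + consL k c (mvD k i η) := by
  induction η using multiVec_induction with
  | h0 => simp
  | h1 η ξ h h' => simp only [map_add, h, h']; abel
  | h2 a x =>
    rw [consL_single, mvD_single, mvD_single, map_add, map_sum, Fin.sum_univ_succ]
    simp only [consL_single, Fin.cons_zero, Fin.cons_succ, Fin.update_cons_zero, Fin.cons_update]
    abel

theorem consL_apply_mem {I : Ideal (𝒜 M r)} {k : ℕ} (c : Lab p q) {η : MultiVec M r k}
    (h : ∀ a, η a ∈ I) (b : Fin (k + 1) → Lab p q) : consL k c η b ∈ I := by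
  have hinj : Function.Injective fun a : Fin k → Lab p q => (Fin.cons c a : Fin (k + 1) → Lab p q) :=
    fun a b h => (Fin.cons_inj.1 h).2
  by_cases hb : b ∈ Set.range fun a : Fin k → Lab p q => (Fin.cons c a : Fin (k + 1) → Lab p q)
  · obtain ⟨a, rfl⟩ := hb
    have : consL k c η (Fin.cons c a : Fin (k + 1) → Lab p q) = η a :=
      Finsupp.mapDomain_apply hinj η a
    simp only
    rw [this]
    exact h a
  · have : consL k c η b = 0 := Finsupp.mapDomain_of_notMem_range η b hb
    rw [this]
    exact I.zero_mem

/-- Integration by parts: `θ_{J,i} ∧ μ = D_i(θ_J ∧ μ) - θ_J ∧ D_i μ`. -/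
theorem exists_consL_eq {k : ℕ} (α : Fin q) (J : MultiIndex p) (μ : MultiVec M r k) :
    ∃ μ' X, consL k (α, J) μ = consL k (α, 0) μ' + mvDiv (k + 1) X := by
  induction J using MultiIndex.induction generalizing μ with
  | h0 => exact ⟨μ, 0, by rw [map_zero, add_zero]⟩
  | h1 i J ih =>
    obtain ⟨ν, X, hX⟩ := ih ((-1 : ℝ) • mvD k i μ)
    refine ⟨ν, X + Pi.single i (consL k (α, J) μ), ?_⟩
    have h1 : mvDiv (k + 1) (Pi.single i (consL k (α, J) μ)) =
        mvD (k + 1) i (consL k (α, J) μ) := by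
      rw [mvDiv_apply, Finset.sum_eq_single i (fun j _ hj => by simp [hj]) (by simp)]
      simp
    have h2 : ∀ v : MultiVec M r (k + 1), (-1 : ℝ) • v + v = 0 := fun v => by
      nth_rw 2 [← one_smul ℝ v]
      rw [← add_smul, neg_add_cancel, zero_smul]
    rw [map_add, ← add_assoc, ← hX, h1, mvD_consL, map_smul, add_left_comm, h2, add_zero]
    rfl

theorem exists_normal_form {k : ℕ} (η : MultiVec M r (k + 1)) :
    ∃ (C : Fin q → MultiVec M r k) (X : Fin p → MultiVec M r (k + 1)),
      η = ∑ α, consL k (α, 0) (C α) + mvDiv (k + 1) X := by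
  induction η using multiVec_induction with
  | h0 => exact ⟨0, 0, by simp⟩
  | h1 η ξ h h' =>
    obtain ⟨C, X, hC⟩ := h
    obtain ⟨C', X', hC'⟩ := h'
    refine ⟨C + C', X + X', ?_⟩
    rw [hC, hC']
    simp only [Pi.add_apply, map_add, Finset.sum_add_distrib]
    abel
  | h2 a c =>
    obtain ⟨μ, X, hμ⟩ := exists_consL_eq (a 0).1 (a 0).2 (Finsupp.single (Fin.tail a) c)
    refine ⟨Pi.single (a 0).1 μ, X, ?_⟩
    rw [Finset.sum_eq_single (a 0).1 (fun β _ hβ => by simp [hβ]) (by simp), Pi.single_eq_same,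
      ← hμ, consL_single]
    congr 1
    exact (Fin.cons_self_tail a).symm

/-- With the other arguments fixed, the pairing is a differential operator in the first one. Reading
off its coefficients removes one slot at a time. -/
theorem coeff_mem_of_pair {I : Ideal (𝒜 M r)} {k : ℕ} (C : MultiVec M r k)
    (h : ∀ (β : Fin k → Fin q) (φ : Fin k → 𝒜 M r), (∀ s, IsBaseFunction (φ s)) →
      pair (fun s => Pi.single (β s) (φ s)) C ∈ I) (b : Fin k → Lab p q) : C b ∈ I := by
  classical
  induction k with
  | zero =>
    have hC : C = Finsupp.single b (C b) := by
      refine Finsupp.ext fun a => ?_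
      rw [Subsingleton.elim a b, Finsupp.single_eq_same]
    have := h Fin.elim0 Fin.elim0 fun s => s.elim0
    rw [hC, pair_single] at this
    simpa using this
  | succ k ih =>
    -- The part of `C` whose first label is `b 0`, with that label removed.
    set B : MultiVec M r k := C.sum fun a x =>
      if a 0 = b 0 then Finsupp.single (Fin.tail a) x else 0 with hB
    have hBb : B (Fin.tail b) = C b := by
      rw [hB, Finsupp.sum_apply, Finsupp.sum, Finset.sum_eq_single b]
      · simp
      · intro a _ hab
        split_ifs with h0
        · rw [Finsupp.single_apply, if_neg]
          intro h1
          refine hab ?_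
          rw [← Fin.cons_self_tail a, ← Fin.cons_self_tail b, h0, h1]
        · rfl
      · intro hb
        simp [Finsupp.notMem_support_iff.1 hb]
    rw [← hBb]
    refine ih B (fun β φ hφ => ?_) _
    set G : Fin k → Fin q → 𝒜 M r := fun s => Pi.single (β s) (φ s) with hG
    -- The coefficients of the operator acting on the component `(b 0).1` of the first argument, the
    -- rest being fixed as `G`.
    set a : MultiIndex p →₀ 𝒜 M r := C.sum fun d x =>
      if (d 0).1 = (b 0).1 then Finsupp.single (d 0).2 (pair G (Finsupp.single (Fin.tail d) x))
        else 0 with ha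
    have h1 : a (b 0).2 = pair G B := by
      rw [ha, hB, Finsupp.sum_apply, map_finsuppSum]
      refine Finsupp.sum_congr fun d _ => ?_
      by_cases h1 : (d 0).1 = (b 0).1
      · by_cases h2 : (d 0).2 = (b 0).2
        · simp [show d 0 = b 0 from Prod.ext h1 h2]
        · simp [h1, h2, show d 0 ≠ b 0 from fun h => h2 (by rw [h])]
      · simp [h1, show d 0 ≠ b 0 from fun h => h1 (by rw [h])]
    rw [← h1]
    refine IsJetIdeal.coeff_mem_left (fun ψ hψ => ?_) _
    have h2 := h (Fin.cons (b 0).1 β) (Fin.cons ψ φ) (fun s => by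
      refine Fin.cases ?_ (fun s => ?_) s
      · simpa using hψ
      · simpa using hφ s)
    convert h2 using 1
    rw [ha, Finsupp.sum_sum_index (by simp) (by simp [add_mul]), pair_apply]
    refine Finsupp.sum_congr fun d _ => ?_
    rw [Fin.prod_univ_succ]
    by_cases h1 : (d 0).1 = (b 0).1
    · rw [if_pos h1, Finsupp.sum_single_index (by simp), pair_single]
      simp only [Fin.cons_zero, Fin.cons_succ, h1, Pi.single_eq_same, hG, Fin.tail]
      ring
    · simp [h1]

/-- A functional multi-vector is trivial modulo `I` as soon as it vanishes on test characteristics,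
all of which are variational derivatives. -/
theorem IsJetIdeal.multiVec_trivial {I : Ideal (𝒜 M r)} (hI : IsJetIdeal I) {k : ℕ}
    {η : MultiVec M r (k + 1)}
    (h : ∀ L : Fin (k + 1) → 𝒜 M r, integral I (pair (fun s => euler (L s)) (altL _ η)) = 0) :
    ∃ X, ∀ a, altL (k + 1) (η + mvDiv (k + 1) X) a ∈ I := by
  obtain ⟨C, X, hX⟩ := exists_normal_form (altL (k + 1) η)
  -- The first argument ranges over `ψ e_α` and `ψ u^α e_α`, as the fundamental lemma requires; for
  -- the others `φ e_β` is enough.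
  have hC : ∀ α b, C α b ∈ I := by
    intro α
    refine coeff_mem_of_pair (C α) fun β φ hφ => ?_
    choose L hL using fun s => exists_euler_eq_single_base (hφ s) (β s)
    have key : ∀ L' ψ, euler L' = Pi.single α ψ →
        integral I (ψ * pair (fun s => Pi.single (β s) (φ s)) (C α)) = 0 := by
      intro L' ψ hL'
      have h1 := h (Fin.cons L' L)
      have h2 : (fun s => euler ((Fin.cons L' L : Fin (k + 1) → 𝒜 M r) s)) =
          (Fin.cons (euler L') fun s => euler (L s) : Fin (k + 1) → Fin q → 𝒜 M r) := by
        funext s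
        refine Fin.cases ?_ (fun s => ?_) s <;> simp
      rw [h2, hX, map_add, map_add, integral_pair_mvDiv, add_zero,
        map_sum] at h1
      simp only [pair_consL, totalDJ_zero] at h1
      rw [Finset.sum_eq_single α (fun γ _ hγ => by simp [hL', hγ]) (by simp), hL',
        Pi.single_eq_same] at h1
      simpa only [hL] using h1
    refine hI.mem_of_integral α (fun ψ hψ => ?_) (fun ψ hψ => ?_)
    · obtain ⟨P, hP⟩ := exists_euler_eq_single_base hψ α
      exact key P ψ hP
    · obtain ⟨P, hP⟩ := exists_euler_eq_single_base_mul hψ α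
      exact key P _ hP
  -- Antisymmetrizing twice multiplies by `(k+1)!`, so the divergence in the normal form of `altL η`
  -- must be rescaled by its inverse.
  refine ⟨(-((k + 1).factorial : ℝ)⁻¹) • X, fun a => ?_⟩
  have h1 : altL (k + 1) (η + mvDiv (k + 1) ((-((k + 1).factorial : ℝ)⁻¹) • X)) =
      ((k + 1).factorial : ℝ)⁻¹ • altL (k + 1) (∑ α, consL k (α, 0) (C α)) := by
    have h2 := congrArg (altL (k + 1)) hX
    rw [altL_altL, map_add] at h2
    have h3 := congrArg (((k + 1).factorial : ℝ)⁻¹ • ·) h2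
    simp only [smul_smul, smul_add] at h3
    rw [inv_mul_cancel₀ (by positivity), one_smul] at h3
    rw [map_add, map_smul, map_smul, h3, add_assoc, ← add_smul, add_neg_cancel, zero_smul,
      add_zero]
  rw [h1, Finsupp.smul_apply, altL_apply]
  refine I.smul_of_tower_mem _ (I.sum_mem fun σ _ => zsmul_mem ?_ _)
  rw [Finsupp.finsetSum_apply]
  exact I.sum_mem fun α _ => consL_apply_mem _ (hC α) _

/-! ### The Jacobi identity -/

theorem pair_wedge {k : ℕ} (P : Fin q → 𝒜 M r) (G : Fin k → Fin q → 𝒜 M r) (v : MultiVec M r 1)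
    (η : MultiVec M r k) : pair (Fin.cons P G : Fin (k + 1) → Fin q → 𝒜 M r) (v.wedge η) =
      pair (fun _ => P) v * pair G η := by
  rw [MultiVec.wedge, map_finsuppSum, pair_apply _ v, Finsupp.sum_mul]
  refine Finsupp.sum_congr fun b _ => ?_
  rw [map_finsuppSum, pair_apply _ η, Finsupp.mul_sum]
  refine Finsupp.sum_congr fun a _ => ?_
  rw [pair_single, Fin.prod_univ_succ]
  simp only [Fin.cons_zero, Fin.cons_succ, Finset.univ_unique, Fin.default_eq_zero,
    Finset.prod_singleton]
  ring

theorem pair_opTheta (P : Fin q → 𝒜 M r) (D : MatDiffOp M r) (α : Fin q) :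
    pair (fun _ => P) (opTheta D α) = D.apply P α := by
  rw [opTheta, map_sum, MatDiffOp.apply_eq]
  refine Finset.sum_congr rfl fun β _ => ?_
  rw [map_finsuppSum]
  exact Finsupp.sum_congr fun J _ => by simp [pair_single]

theorem pair_iterOp {k : ℕ} (G : Fin k → Fin q → 𝒜 M r) (J : MultiIndex p) (η : MultiVec M r k) :
    pair G (iterOp MultiVec.totalDeriv J η) = totalDJ J (pair G η) := by
  rw [totalDJ_apply]
  exact iterOp_semiconj (fun i v => pair_mvD i G v) J η

/-- Only the coefficients are differentiated along `DP`; the arguments replacing the `θ`'s are not.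
-/
theorem pair_prolong {k : ℕ} (D : MatDiffOp M r) (P : Fin q → 𝒜 M r)
    (G : Fin k → Fin q → 𝒜 M r) (η : MultiVec M r k) :
    pair (Fin.cons P G : Fin (k + 1) → Fin q → 𝒜 M r) (prolong D η) =
      η.sum fun a c => prEv (D.apply P) c * ∏ s, totalDJ (a s).2 (G s (a s).1) := by
  rw [prolong, map_finsuppSum]
  refine Finsupp.sum_congr fun a _ => ?_
  have hfin : Function.HasFiniteSupport fun c : Lab p q =>
      MultiVec.wedge (iterOp MultiVec.totalDeriv c.2 (opTheta D c.1))
        (Finsupp.single a (pderiv c.u (η a))) :=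
    (finite_pderiv_u_ne_zero (η a)).subset fun c hc h => hc (by simp [MultiVec.wedge, h])
  rw [map_finsum _ hfin, prEv_apply, mul_comm, ← smul_eq_mul, smul_finsum']
  · refine finsum_congr fun c => ?_
    rw [pair_wedge, pair_iterOp, pair_opTheta, pair_single, smul_eq_mul]
    ring
  · exact (finite_pderiv_u_ne_zero (η a)).subset fun c hc h => hc (by simp [h])

theorem cons_const (Q R : Fin q → 𝒜 M r) :
    (Fin.cons Q fun _ => R : Fin 2 → Fin q → 𝒜 M r) = ![Q, R] := by
  funext s
  fin_cases s <;> rfl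

theorem pair_bivector (E : MatDiffOp M r) (Q R : Fin q → 𝒜 M r) :
    pair ![Q, R] (bivector E) = (1 / 2 : ℝ) • ∑ α, Q α * E.apply R α := by
  rw [bivector, map_smul, map_sum, ← cons_const]
  simp only [pair_wedge, pair_opTheta, pair_single, Finset.univ_unique, Finset.prod_singleton,
    totalDJ_zero, one_mul]

theorem prEv_pair_two (V Q R : Fin q → 𝒜 M r) (η : MultiVec M r 2) :
    prEv V (pair ![Q, R] η) =
      (η.sum fun a c => prEv V c * ∏ s, totalDJ (a s).2 ((![Q, R] : Fin 2 → _) s (a s).1)) +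
        pair ![fun α => prEv V (Q α), R] η + pair ![Q, fun α => prEv V (R α)] η := by
  simp only [pair_apply, map_finsuppSum]
  rw [← Finsupp.sum_add, ← Finsupp.sum_add]
  refine Finsupp.sum_congr fun a _ => ?_
  simp only [Fin.prod_univ_two, Derivation.leibniz, smul_eq_mul, Matrix.cons_val_zero,
    Matrix.cons_val_one, prEv_totalDJ]
  ring

/-- `Q · E'[D P] R`, where `E'[V]` is the Fréchet derivative of the operator `E` in the direction
`V`. -/
def frechetForm (D E : MatDiffOp M r) (P Q R : Fin q → 𝒜 M r) : 𝒜 M r :=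
  ∑ α, Q α * (prEv (D.apply P) (E.apply R α) - E.apply (fun β => prEv (D.apply P) (R β)) α)

/-- Differentiating `Q · E R` along `DP` and discarding the variations of `Q` and `R` leaves the
variation of the coefficients of `E`; the factor `½` is that of `Θ_E`. -/
theorem pair_prolong_bivector (D E : MatDiffOp M r) (P Q R : Fin q → 𝒜 M r) :
    pair ![P, Q, R] (prolong D (bivector E)) = (1 / 2 : ℝ) • frechetForm D E P Q R := by
  have h := prEv_pair_two (D.apply P) Q R (bivector E)
  have h1 := pair_prolong D P ![Q, R] (bivector E)
  have h2 : (Fin.cons P ![Q, R] : Fin 3 → Fin q → 𝒜 M r) = ![P, Q, R] := rfl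
  rw [h2] at h1
  rw [← h1, pair_bivector, pair_bivector, pair_bivector, Derivation.map_smul, map_sum] at h
  rw [add_assoc, ← sub_eq_iff_eq_add, ← smul_add, ← smul_sub] at h
  rw [← h, frechetForm, ← Finset.sum_add_distrib, ← Finset.sum_sub_distrib]
  congr 1
  refine Finset.sum_congr rfl fun α _ => ?_
  rw [Derivation.leibniz, smul_eq_mul, smul_eq_mul]
  ring

/-- The Fréchet derivative of a skew-adjoint operator is skew-adjoint: differentiate `∫ (Q·ER +
R·EQ) = 0` along `DP` and subtract the same identity for the varied arguments. -/
theorem IsJetIdeal.integral_frechetForm_swap {I : Ideal (𝒜 M r)} (hI : IsJetIdeal I)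
    {E : MatDiffOp M r} (hE : SkewMod I E) (D : MatDiffOp M r) (P Q R : Fin q → 𝒜 M r) :
    integral I (frechetForm D E P Q R) = - integral I (frechetForm D E P R Q) := by
  set v : Derivation ℝ (𝒜 M r) (𝒜 M r) := prEv (D.apply P) with hv
  have h1 := hI.integral_prEv (D.apply P)
    (f := ∑ α, Q α * E.apply R α + ∑ α, R α * E.apply Q α) (by rw [map_add, hE Q R]; abel)
  have h2 := hE (fun α => v (Q α)) R
  have h3 := hE (fun α => v (R α)) Q
  simp only [map_add, map_sum, Derivation.leibniz, smul_eq_mul, Finset.sum_add_distrib,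
    ← hv, mul_comm (E.apply _ _) (v _)] at h1 h2 h3
  simp only [frechetForm, mul_sub, Finset.sum_sub_distrib, map_sub, map_sum, ← hv]
  linear_combination (norm := module) h1 - h2 - h3

/-- The cyclic sum of the integrals of `frechetForm`. -/
def jacobiForm (I : Ideal (𝒜 M r)) (D E : MatDiffOp M r) (P Q R : Fin q → 𝒜 M r) :
    𝒜 M r ⧸ nullDensities I :=
  integral I (frechetForm D E P Q R) + integral I (frechetForm D E Q R P) +
    integral I (frechetForm D E R P Q)

theorem sum_perm_fin_three {V : Type*} [AddCommMonoid V] (f : Equiv.Perm (Fin 3) → V) :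
    ∑ σ, f σ = f 1 + (f (Equiv.swap 0 1) + (f (Equiv.swap 0 2) + (f (Equiv.swap 1 2) +
      (f (Equiv.swap 0 1 * Equiv.swap 1 2) + f (Equiv.swap 1 2 * Equiv.swap 0 1))))) := by
  have : (Finset.univ : Finset (Equiv.Perm (Fin 3))) = {1, Equiv.swap 0 1, Equiv.swap 0 2,
    Equiv.swap 1 2, Equiv.swap 0 1 * Equiv.swap 1 2, Equiv.swap 1 2 * Equiv.swap 0 1} := by decide
  rw [this]
  repeat rw [Finset.sum_insert (by decide)]
  rw [Finset.sum_singleton]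

/-- By skewness in the last two arguments, the six terms of the antisymmetrization agree in pairs.
The factor `½` then leaves the three cyclic terms. -/
theorem IsJetIdeal.integral_pair_altL_prolong {I : Ideal (𝒜 M r)} (hI : IsJetIdeal I)
    {E : MatDiffOp M r} (hE : SkewMod I E) (D : MatDiffOp M r) (P Q R : Fin q → 𝒜 M r) :
    integral I (pair ![P, Q, R] (altL 3 (prolong D (bivector E)))) = jacobiForm I D E P Q R := by
  have hc : ∀ σ : Equiv.Perm (Fin 3), (![P, Q, R] : Fin 3 → Fin q → 𝒜 M r) ∘ σ =
      ![(![P, Q, R] : Fin 3 → _) (σ 0), (![P, Q, R] : Fin 3 → _) (σ 1),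
        (![P, Q, R] : Fin 3 → _) (σ 2)] := by
    intro σ
    funext s
    fin_cases s <;> rfl
  rw [pair_altL, map_sum]
  simp only [hc, pair_prolong_bivector, map_smul]
  rw [sum_perm_fin_three]
  have e1 : (Equiv.Perm.sign (1 : Equiv.Perm (Fin 3)) : ℤ) = 1 := by decide
  have e2 : (Equiv.Perm.sign (Equiv.swap 0 1 : Equiv.Perm (Fin 3)) : ℤ) = -1 := by decide
  have e3 : (Equiv.Perm.sign (Equiv.swap 0 2 : Equiv.Perm (Fin 3)) : ℤ) = -1 := by decide
  have e4 : (Equiv.Perm.sign (Equiv.swap 1 2 : Equiv.Perm (Fin 3)) : ℤ) = -1 := by decide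
  have e5 : (Equiv.Perm.sign (Equiv.swap 0 1 * Equiv.swap 1 2 : Equiv.Perm (Fin 3)) : ℤ) = 1 := by
    decide
  have e6 : (Equiv.Perm.sign (Equiv.swap 1 2 * Equiv.swap 0 1 : Equiv.Perm (Fin 3)) : ℤ) = 1 := by
    decide
  have v : ∀ σ : Equiv.Perm (Fin 3), ∀ i j k : Fin 3, σ 0 = i → σ 1 = j → σ 2 = k →
      frechetForm D E ((![P, Q, R] : Fin 3 → _) (σ 0)) ((![P, Q, R] : Fin 3 → _) (σ 1))
        ((![P, Q, R] : Fin 3 → _) (σ 2)) = frechetForm D E ((![P, Q, R] : Fin 3 → _) i)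
        ((![P, Q, R] : Fin 3 → _) j) ((![P, Q, R] : Fin 3 → _) k) := by
    rintro σ i j k rfl rfl rfl; rfl
  rw [e1, e2, e3, e4, e5, e6, v 1 0 1 2 (by decide) (by decide) (by decide),
    v (Equiv.swap 0 1) 1 0 2 (by decide) (by decide) (by decide),
    v (Equiv.swap 0 2) 2 1 0 (by decide) (by decide) (by decide),
    v (Equiv.swap 1 2) 0 2 1 (by decide) (by decide) (by decide),
    v (Equiv.swap 0 1 * Equiv.swap 1 2) 1 2 0 (by decide) (by decide) (by decide),
    v (Equiv.swap 1 2 * Equiv.swap 0 1) 2 0 1 (by decide) (by decide) (by decide)]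
  change _ • _ • integral I (frechetForm D E P Q R) + (_ • _ • integral I (frechetForm D E Q P R) +
    (_ • _ • integral I (frechetForm D E R Q P) + (_ • _ • integral I (frechetForm D E P R Q) +
    (_ • _ • integral I (frechetForm D E Q R P) + _ • _ • integral I (frechetForm D E R P Q))))) = _
  rw [hI.integral_frechetForm_swap hE D Q P R, hI.integral_frechetForm_swap hE D R Q P,
    hI.integral_frechetForm_swap hE D P R Q, jacobiForm]
  push_cast
  module

/-- By the first variation formula the outer bracket is `∫ pr v_{DδR}(δP · DδL)`. The Leibniz rule
applies, and skew-adjointness moves `D` off the varied `δL`. -/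
theorem IsJetIdeal.integral_bracket_bracket {I : Ideal (𝒜 M r)} {D : MatDiffOp M r}
    (hD : SkewMod I D) (P L R : 𝒜 M r) :
    integral I (bracket D (bracket D P L) R) =
      integral I (frechetForm D D (euler R) (euler P) (euler L)) +
      integral I (∑ α, D.apply (euler L) α * prEv (D.apply (euler R)) (euler P α)) -
      integral I (∑ α, D.apply (euler P) α * prEv (D.apply (euler R)) (euler L α)) := by
  have h1 : integral I (bracket D (bracket D P L) R) =
      integral I (prEv (D.apply (euler R)) (bracket D P L)) := by
    rw [← integral_sum_mul_euler]
    simp only [bracket, mul_comm]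
  have h2 := hD (euler P) fun α => prEv (D.apply (euler R)) (euler L α)
  rw [h1]
  simp only [bracket, frechetForm, map_add, map_sum, Derivation.leibniz, smul_eq_mul,
    Finset.sum_add_distrib, mul_sub, Finset.sum_sub_distrib, map_sub,
    mul_comm (D.apply (euler P) _)] at h2 ⊢
  linear_combination (norm := module) h2

/-- The six terms with varied variational derivatives cancel in pairs, by self-adjointness of the
Fréchet derivatives of `δP`, `δL`, `δR`. -/
theorem IsJetIdeal.integral_jacobi {I : Ideal (𝒜 M r)} (hI : IsJetIdeal I) {D : MatDiffOp M r}
    (hD : SkewMod I D) (P L R : 𝒜 M r) :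
    integral I (bracket D (bracket D P L) R + bracket D (bracket D L R) P +
      bracket D (bracket D R P) L) = jacobiForm I D D (euler P) (euler L) (euler R) := by
  rw [map_add, map_add, IsJetIdeal.integral_bracket_bracket hD,
    IsJetIdeal.integral_bracket_bracket hD, IsJetIdeal.integral_bracket_bracket hD,
    hI.integral_mul_prEv_euler (D.apply (euler R)) (D.apply (euler L)) P,
    hI.integral_mul_prEv_euler (D.apply (euler P)) (D.apply (euler R)) L,
    hI.integral_mul_prEv_euler (D.apply (euler L)) (D.apply (euler P)) R, jacobiForm]
  abel

/-! ### Polarization: linear combinations of two operators. -/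

theorem prEv_add_smul (a b : ℝ) (V W : Fin q → 𝒜 M r) (f : 𝒜 M r) :
    prEv (fun α => a • V α + b • W α) f = a • prEv V f + b • prEv W f := by
  simp only [prEv_eq_sum, map_add, map_smul, add_mul, smul_mul_assoc, Finset.sum_add_distrib,
    Finset.smul_sum]

theorem MatDiffOp.apply_add_smul (D : MatDiffOp M r) (a b : ℝ) (V W : Fin q → 𝒜 M r)
    (α : Fin q) :
    D.apply (fun β => a • V β + b • W β) α = a • D.apply V α + b • D.apply W α := by
  simp only [MatDiffOp.apply_eq, Finsupp.sum, map_add, map_smul, mul_add, mul_smul_comm,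
    Finset.sum_add_distrib, Finset.smul_sum]

/-- `frechetForm` is bilinear in its two operators: one enters through the direction of
differentiation, the other is differentiated. -/
theorem frechetForm_add_smul (D E : MatDiffOp M r) (a b : ℝ) (P Q R : Fin q → 𝒜 M r) :
    frechetForm (a • D + b • E) (a • D + b • E) P Q R =
      (a * a) • frechetForm D D P Q R + (a * b) • (frechetForm D E P Q R + frechetForm E D P Q R) +
        (b * b) • frechetForm E E P Q R := by
  have h1 : MatDiffOp.apply (a • D + b • E) P = fun α => a • D.apply P α + b • E.apply P α := by
    funext α
    rw [MatDiffOp.apply_add_op, MatDiffOp.apply_smul_op, MatDiffOp.apply_smul_op]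
  simp only [frechetForm, Finset.smul_sum, ← Finset.sum_add_distrib]
  refine Finset.sum_congr rfl fun α _ => ?_
  simp only [MatDiffOp.apply_add_op, MatDiffOp.apply_smul_op, h1, map_add, Derivation.map_smul,
    prEv_add_smul, MatDiffOp.apply_add_smul, mul_sub, mul_add, mul_smul_comm]
  module

theorem jacobiForm_add_smul (I : Ideal (𝒜 M r)) (D E : MatDiffOp M r) (a b : ℝ)
    (P Q R : Fin q → 𝒜 M r) :
    jacobiForm I (a • D + b • E) (a • D + b • E) P Q R =
      (a * a) • jacobiForm I D D P Q R +
        (a * b) • (jacobiForm I D E P Q R + jacobiForm I E D P Q R) +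
        (b * b) • jacobiForm I E E P Q R := by
  simp only [jacobiForm, frechetForm_add_smul, map_add, map_smul]
  module

/-! ### The equivalence. -/

theorem isApproxHamiltonian_iff {N : ℕ} {D : MatDiffOp M r} (hD : SkewMod (smallIdeal M r N) D) :
    IsApproxHamiltonian N D ↔
      ∀ P L R : 𝒜 M r, jacobiForm (smallIdeal M r N) D D (euler P) (euler L) (euler R) = 0 := by
  have h : ∀ P L : 𝒜 M r, IntegralSmall N (bracket D P L + bracket D L P) := fun P L => by
    rw [integralSmall_iff, map_add, ← eq_neg_iff_add_eq_zero]
    exact hD _ _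
  simp only [IsApproxHamiltonian, integralSmall_iff,
    (isJetIdeal_smallIdeal N).integral_jacobi hD] at h ⊢
  exact and_iff_right h

/-- Evaluation on variational derivatives gives one direction; the other holds because these suffice
to detect triviality. -/
theorem integralSmall_mixed_iff {N : ℕ} {D E : MatDiffOp M r}
    (hD : SkewMod (smallIdeal M r N) D) (hE : SkewMod (smallIdeal M r N) E) :
    MultiVec.IntegralSmall N (prolong D (bivector E) + prolong E (bivector D)) ↔
      ∀ P L R : 𝒜 M r, jacobiForm (smallIdeal M r N) D E (euler P) (euler L) (euler R) +
        jacobiForm (smallIdeal M r N) E D (euler P) (euler L) (euler R) = 0 := by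
  have hI := isJetIdeal_smallIdeal (M := M) (r := r) N
  have h : ∀ P L R : 𝒜 M r, integral (smallIdeal M r N) (pair ![euler P, euler L, euler R]
      (altL 3 (prolong D (bivector E) + prolong E (bivector D)))) =
      jacobiForm (smallIdeal M r N) D E (euler P) (euler L) (euler R) +
        jacobiForm (smallIdeal M r N) E D (euler P) (euler L) (euler R) := fun P L R => by
    rw [map_add, map_add, map_add, hI.integral_pair_altL_prolong hE,
      hI.integral_pair_altL_prolong hD]
  rw [integralSmall_multiVec_iff]
  constructor
  · intro hX P L R
    rw [← h]
    exact integral_pair_altL_eq_zero hX _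
  · intro h0
    refine hI.multiVec_trivial fun L => ?_
    have : (fun s => euler (L s)) = ![euler (L 0), euler (L 1), euler (L 2)] := by
      funext s
      fin_cases s <;> rfl
    rw [this, h, h0]

theorem isApproxHamiltonianPair_iff {N : ℕ} {D E : MatDiffOp M r} (hD : IsSkewAdjoint D)
    (hE : IsSkewAdjoint E) (hD' : IsApproxHamiltonian N D) (hE' : IsApproxHamiltonian N E) :
    IsApproxHamiltonianPair N D E ↔
      MultiVec.IntegralSmall N (prolong D (bivector E) + prolong E (bivector D)) := by
  have sD := (isSkewAdjoint_iff.1 hD).of_bot (smallIdeal M r N)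
  have sE := (isSkewAdjoint_iff.1 hE).of_bot (smallIdeal M r N)
  rw [isApproxHamiltonian_iff sD] at hD'
  rw [isApproxHamiltonian_iff sE] at hE'
  rw [integralSmall_mixed_iff sD sE]
  constructor
  · rintro ⟨-, -, h⟩ P L R
    -- The single combination `D + E` already yields the mixed condition.
    have h1 := (isApproxHamiltonian_iff (sD.add_smul sE 1 1)).1 (h 1 1) P L R
    rw [jacobiForm_add_smul, hD', hE'] at h1
    simpa using h1
  · refine fun h => ⟨hD, hE, fun a b => ?_⟩
    rw [isApproxHamiltonian_iff (sD.add_smul sE a b)]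
    intro P L R
    simp [jacobiForm_add_smul, hD', hE', h]

theorem IsHamiltonian.isApproxHamiltonian {D : MatDiffOp M r} (h : IsHamiltonian D) (N : ℕ) :
    IsApproxHamiltonian N D :=
  ⟨fun P L => integralSmall_iff.2 (integral_eq_zero_of_bot (integralZero_iff.1 (h.1 P L))),
    fun P L R => integralSmall_iff.2 (integral_eq_zero_of_bot (integralZero_iff.1 (h.2 P L R)))⟩

end ApproxHam

end

theorem mainTheorem6 {p q : ℕ} (M : ApproxHam.BaseDomain p q) (r : ℝ) (hr : 0 < r) (N : ℕ)
    (D E : ApproxHam.MatDiffOp M r) :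
    (ApproxHam.IsHamiltonian D → ApproxHam.IsHamiltonian E →
      (ApproxHam.IsApproxHamiltonianPair N D E ↔
        ApproxHam.MultiVec.IntegralSmall N
          (ApproxHam.prolong D (ApproxHam.bivector E) +
            ApproxHam.prolong E (ApproxHam.bivector D)))) ∧
    (ApproxHam.IsSkewAdjoint D → ApproxHam.IsSkewAdjoint E →
      ApproxHam.IsApproxHamiltonian N D → ApproxHam.IsApproxHamiltonian N E →
      (ApproxHam.IsApproxHamiltonianPair N D E ↔
        ApproxHam.MultiVec.IntegralSmall N
          (ApproxHam.prolong D (ApproxHam.bivector E) +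
            ApproxHam.prolong E (ApproxHam.bivector D)))) :=
  ⟨fun hD hE => ApproxHam.isApproxHamiltonianPair_iff (ApproxHam.isSkewAdjoint_of_bracket hD.1)
      (ApproxHam.isSkewAdjoint_of_bracket hE.1) (hD.isApproxHamiltonian N)
      (hE.isApproxHamiltonian N),
    ApproxHam.isApproxHamiltonianPair_iff⟩
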